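/- Let $\mathcal X$ be a measurable space, let $k\ge 1$, and let $\mathcal D_T$ and $\mathcal D_{S_1},\dots,\mathcal D_{S_k}$ be probability distributions on $\mathcal X$ (the target and the $k$ sources). Let $\mathcal H$ be a class of measurable functions $h:\mathcal X\to\{0,1\}$ with VC dimension $d$, that is, $d=\max\{n:\Pi_{\mathcal H}(n)=2^n\}$, where $\Pi_{\mathcal H}(n)$ is the largest number of labellings $(h(x_1),\dots,h(x_n))$, $h\in\mathcal H$, of $n$ distinct points of $\mathcal X$. Put $\mathcal A_{\mathcal H}=\{h^{-1}(\{1\}):h\in\mathcal H\}$ and, for probability measures $P,Q_1,\dots,Q_k$ on $\mathcal X$, $$d_{\mathcal H}(P;\{Q_i\}_{i=1}^k)=\max_{1\le i\le k}\,2\sup_{A\in\mathcal A_{\mathcal H}}|P(A)-Q_i(A)| .$$ Assume that $\mathcal H$ is a measurable class in the usual sense of empirical process theory: for all $n$, all $P_1,\dots,P_n\in\{\mathcal D_T,\mathcal D_{S_1},\dots,\mathcal D_{S_k}\}$ and all $c\in\mathbb R^n$, the function $(z_1,\dots,z_n)\mapsto\sup_{h\in\mathcal H}\bigl|\sum_j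 c_jh(z_j)\bigr|$ is measurable for the completion of $P_1\otimes\cdots\otimes P_n$ (this is automatic if $\mathcal H$ is countable). Let $m\ge 1$ with $m\ge d$, and let $\widehat{\mathcal D}_T$ and $\widehat{\mathcal D}_{S_1},\dots,\widehat{\mathcal D}_{S_k}$ be the empirical distributions of $m$ i.i.d. samples from each of $\mathcal D_T,\mathcal D_{S_1},\dots,\mathcal D_{S_k}$, all $(k+1)m$ sample points being independent. Then, for every $0<\delta<1$, with probability at least $1-\delta$ over the choice of the samples, $$\left|d_{\mathcal H}(\mathcal D_T;\{\mathcal D_{S_i}\}_{i=1}^k)-d_{\mathcal H}(\widehat{\mathcal D}_T;\{\widehat{\mathcal D}_{S_i}\}_{i=1}^k)\right|\le 2\sqrt{\frac2m\left(\log\frac{4k}{\delta}+d\log\frac{em}{d}\right)},$$ where $d\log(em/d)$ is read as $0$ when $d=0$. (In particular, the event in question is measurable for the completed probability.) -/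

import Mathlib

open MeasureTheory ProbabilityTheory
open scoped ENNReal

noncomputable section

/-- The collection `{h⁻¹({1}) | h ∈ H}` of the sets cut out by a class of binary hypotheses. -/
def hypothesisSets {X : Type*} (H : Set (X → Bool)) : Set (Set X) :=
  (fun h : X → Bool => h ⁻¹' {true}) '' H

/-- The growth function: the largest number of labellings that `H` induces on a set of
`n` distinct points (with value `0` if there are fewer than `n` points). -/
def growthFunction {X : Type*} (H : Set (X → Bool)) (n : ℕ) : ℕ :=
  ⨆ S : {S : Finset X // S.card = n},
    Set.ncard ((fun (h : X → Bool) (x : {x // x ∈ S.1}) => h x) '' H)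

/-- `VCdim(H) = d`, where `VCdim(H) = max {n | growthFunction H n = 2 ^ n}`. -/
def HasVCDim {X : Type*} (H : Set (X → Bool)) (d : ℕ) : Prop :=
  IsGreatest {n : ℕ | growthFunction H n = 2 ^ n} d

/-- The `H`-divergence `2 sup_A |P(A) - Q(A)|` between two distributions. -/
def hDivergence {X : Type*} [MeasurableSpace X] (H : Set (X → Bool)) (P Q : Measure X) : ℝ :=
  2 * ⨆ A : hypothesisSets H, |P.real (A : Set X) - Q.real (A : Set X)|

/-- The multi-source `H`-divergence `max_i d_H(P, Q_i)` (the maximum is over a finite set, and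
is used for `0 < k` only). -/
def multiHDivergence {X : Type*} [MeasurableSpace X] (H : Set (X → Bool)) {k : ℕ}
    (P : Measure X) (Q : Fin k → Measure X) : ℝ :=
  ⨆ i : Fin k, hDivergence H P (Q i)

/-- The empirical distribution, with mass `1 / m` at each of the `m` sample points. -/
def empiricalMeasure {X : Type*} [MeasurableSpace X] {m : ℕ} (x : Fin m → X) : Measure X :=
  (m : ℝ≥0∞)⁻¹ • ∑ j : Fin m, Measure.dirac (x j)

/-- The usual regularity condition of empirical process theory (a "measurable class" with respect
to a family `D` of distributions): for independent points `z₁, …, zₙ` with laws in `D` and real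
weights `c₁, …, cₙ`, the supremum over `h ∈ H` of `|∑ cⱼ h(zⱼ)|` is measurable with respect to the
completion of the joint law. Every countable class of measurable hypotheses has it. -/
def IsMeasurableClass {X : Type*} [MeasurableSpace X] (H : Set (X → Bool))
    (D : Set (Measure X)) : Prop :=
  ∀ (n : ℕ) (P : Fin n → Measure X), (∀ j, P j ∈ D) → ∀ c : Fin n → ℝ,
    AEMeasurable
      (fun z : Fin n → X => ⨆ h : H, |∑ j, c j * (if (h : X → Bool) (z j) = true then 1 else 0)|)
      (Measure.pi P)

end

/-! The maximum over sources costs only a union bound, so consider one source, with Δ = sup |P(A) −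
Q(A)| over the class and Z its empirical counterpart. Divergences carry a factor 2, so the allowed
deviation of Z from Δ is t, where m t²/2 = c + d log(em/d) and c = log(4k/δ). If t ≥ 1 the claim is
trivial, since divergences lie in [0, 2].

Lower tail, Z ≤ Δ − t: one nearly optimal hypothesis suffices, so Hoeffding's inequality applies
without a union over the class and gives e^{-c} (`measure_labelSum_le`).

Upper tail, Z ≥ Δ + t: each sample point receives 11 ghost points of the same law. Real points have
weight ±α and ghosts ∓η. By Jensen, integrating out the ghosts costs at most a factor exp(11ηmΔ), so
Markov's inequality reduces the tail to an exponential moment on 24m points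
(`measure_labelSup_ge_le`). That moment is unchanged by moving the real point to a uniformly random
place of its block. For a fixed labelling, the average over these moves factorizes over blocks
(`sum_exp_labelSum_le`), and Sauer's lemma leaves at most (24em/d)^d labellings when d > 0. With
optimal tilts (`exists_ghost_tilt`) the exponent is m times `ghostRate t`, twice the relative
entropy of Bernoulli((1+t)/2) with respect to Bernoulli((1+t/12)/2).

The bound allows only (em/d)^d, so the surplus 24^d must be paid by the rate. It behaves like
(11/12)² t² for small t, more than the t²/2 that is needed; since m t²/2 ≥ d(1 + log(m/d)), the gain
covers d log 24 (`mul_ghostRate_ge`). A block of two points would give only t²/4. The upper tail is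
thus at most 2e^{-c}, and both tails over k sources sum to k · 3δ/(4k) < δ. -/

/-! ### Sauer's lemma and the binomial sum. -/

/-- The labellings of a finite family of points by a class of VC dimension `d`: Sauer's lemma. -/
theorem HasVCDim.card_labellings_le {X ι : Type*} [Fintype ι] [DecidableEq ι] {H : Set (X → Bool)}
    {d : ℕ} (hVC : HasVCDim H d) (z : ι → X) :
    Nat.card ((fun (h : X → Bool) (i : ι) => h (z i)) '' H) ≤
      ∑ i ∈ Finset.Iic d, (Fintype.card ι).choose i := by
  classical
  set P : Set (ι → Bool) := (fun (h : X → Bool) (i : ι) => h (z i)) '' H with hP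
  let e : (ι → Bool) → Finset ι := fun p => Finset.univ.filter fun i => p i = true
  have he : Function.Injective e := by
    intro p q hpq
    funext i
    have : i ∈ e p ↔ i ∈ e q := by rw [hpq]
    simp only [e, Finset.mem_filter, Finset.mem_univ, true_and] at this
    exact Bool.eq_iff_iff.2 this
  let F : Finset (Finset ι) := P.toFinite.toFinset.image e
  have hF : Nat.card P = F.card := by
    rw [Finset.card_image_of_injective _ he, Nat.card_coe_set_eq, Set.ncard_eq_toFinset_card P]
  rw [hF]
  refine F.card_le_card_shatterer.trans (Finset.card_shatterer_le_sum_vcDim.trans ?_)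
  refine Finset.sum_le_sum_of_subset (Finset.Iic_subset_Iic.2 ?_)
  refine Finset.sup_le fun T hT => ?_
  rw [Finset.mem_shatterer] at hT
  refine hVC.2 ?_
  -- The family may repeat points, but a shattered index set separates its indices, so its points
  -- are distinct, as the growth function requires.
  have hinj : Set.InjOn z T := by
    intro i hi j hj hij
    by_contra hne
    obtain ⟨u, hu, hTu⟩ := hT.exists_inter_eq_singleton hi
    obtain ⟨p, hp, rfl⟩ := Finset.mem_image.1 hu
    obtain ⟨h, -, rfl⟩ := (Set.Finite.mem_toFinset _).1 hp
    have h1 : i ∈ T ∩ e fun i => h (z i) := by rw [hTu]; simp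
    have h2 : j ∈ T ∩ e fun i => h (z i) := by
      simp only [e, Finset.mem_inter, Finset.mem_filter, Finset.mem_univ, true_and] at h1 ⊢
      exact ⟨hj, hij ▸ h1.2⟩
    rw [hTu, Finset.mem_singleton] at h2
    exact hne h2.symm
  have hbound : ∀ S : {S : Finset X // S.card = T.card},
      Set.ncard ((fun (h : X → Bool) (x : {x // x ∈ S.1}) => h x) '' H) ≤ 2 ^ T.card := by
    intro S
    refine (Set.ncard_le_ncard (Set.subset_univ _) Set.finite_univ).trans ?_
    rw [Set.ncard_univ, Nat.card_eq_fintype_card]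
    simp [S.2]
  refine le_antisymm (ciSup_le' hbound) ?_
  have hS : (T.image z).card = T.card := Finset.card_image_of_injOn hinj
  refine le_trans ?_ (le_ciSup ⟨_, by rintro _ ⟨S, rfl⟩; exact hbound S⟩ ⟨T.image z, hS⟩)
  have huniv : (fun (h : X → Bool) (x : {x // x ∈ T.image z}) => h x) '' H = Set.univ := by
    refine Set.eq_univ_of_forall fun q => ?_
    obtain ⟨u, hu, hTu⟩ := hT (Finset.filter_subset
      (fun i => ∃ hi : z i ∈ T.image z, q ⟨z i, hi⟩ = true) T)
    obtain ⟨p, hp, rfl⟩ := Finset.mem_image.1 hu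
    obtain ⟨h, hh, rfl⟩ := (Set.Finite.mem_toFinset _).1 hp
    refine ⟨h, hh, funext fun x => ?_⟩
    obtain ⟨x, hx⟩ := x
    obtain ⟨i, hi, rfl⟩ := Finset.mem_image.1 hx
    have := Finset.ext_iff.1 hTu i
    simp only [e, Finset.mem_inter, Finset.mem_filter, Finset.mem_univ, true_and, hi] at this
    exact Bool.eq_iff_iff.2 (this.trans ⟨fun ⟨_, h⟩ => h, fun h => ⟨hx, h⟩⟩)
  simp only [huniv, Set.ncard_univ, Nat.card_eq_fintype_card]
  simp [hS]

/-- After multiplication by (d/n)^d, each term with i ≤ d is at most the corresponding term of the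
binomial expansion of (1 + d/n)^n ≤ e^d. -/
theorem sum_choose_le_exp_mul_div_pow {n d : ℕ} (hd : 0 < d) (hdn : d ≤ n) :
    ((∑ i ∈ Finset.Iic d, n.choose i : ℕ) : ℝ) ≤ (Real.exp 1 * n / d) ^ d := by
  have hd0 : (0 : ℝ) < d := by exact_mod_cast hd
  have hn0 : (0 : ℝ) < n := by exact_mod_cast hd.trans_le hdn
  have hx0 : (0 : ℝ) < d / n := by positivity
  have hx1 : (d / n : ℝ) ≤ 1 := by rw [div_le_one hn0]; exact_mod_cast hdn
  have key : ((∑ i ∈ Finset.Iic d, n.choose i : ℕ) : ℝ) * (d / n : ℝ) ^ d ≤ Real.exp 1 ^ d := by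
    calc ((∑ i ∈ Finset.Iic d, n.choose i : ℕ) : ℝ) * (d / n : ℝ) ^ d
        ≤ ∑ i ∈ Finset.Iic d, (d / n : ℝ) ^ i * (n.choose i : ℝ) := by
          push_cast
          rw [Finset.sum_mul]
          refine Finset.sum_le_sum fun i hi => ?_
          rw [mul_comm]
          exact mul_le_mul_of_nonneg_right
            (pow_le_pow_of_le_one hx0.le hx1 (Finset.mem_Iic.1 hi)) (Nat.cast_nonneg _)
      _ ≤ ∑ i ∈ Finset.range (n + 1), (d / n : ℝ) ^ i * (n.choose i : ℝ) := by
          refine Finset.sum_le_sum_of_subset_of_nonneg (fun i hi => ?_) fun i _ _ => by positivity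
          have := Finset.mem_Iic.1 hi
          exact Finset.mem_range.2 (by omega)
      _ = (d / n + 1 : ℝ) ^ n := by rw [add_pow]; simp
      _ ≤ Real.exp (d / n) ^ n := by gcongr; exact Real.add_one_le_exp _
      _ = Real.exp 1 ^ d := by
          rw [← Real.exp_nat_mul, ← Real.exp_nat_mul]
          congr 1
          field_simp
  rw [div_pow] at key
  rw [div_pow, mul_pow, le_div_iff₀ (by positivity)]
  rw [← mul_div_assoc, div_le_iff₀ (by positivity)] at key
  exact key

/-! ### Numerical inequality: the gain of the rate against log 24. -/

theorem log_three_bounds : 1.0986 < Real.log 3 ∧ Real.log 3 < 1.0987 := by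
  -- The near coincidence of 3^12 = 531441 and 2^19 = 524288 transfers the bounds on log 2 to log 3.
  have h : 12 * Real.log 3 = 19 * Real.log 2 + Real.log (531441 / 524288) := by
    have h1 : Real.log (3 ^ 12 : ℝ) = 12 * Real.log 3 := by rw [Real.log_pow]; norm_num
    have h2 : Real.log (2 ^ 19 : ℝ) = 19 * Real.log 2 := by rw [Real.log_pow]; norm_num
    rw [← h1, ← h2, ← Real.log_mul (by norm_num) (by norm_num)]
    norm_num
  have h1 := Real.log_le_sub_one_of_pos (show (0 : ℝ) < 531441 / 524288 by norm_num)
  have h2 := Real.one_sub_inv_le_log_of_pos (show (0 : ℝ) < 531441 / 524288 by norm_num)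
  have h3 := Real.log_two_gt_d9
  have h4 := Real.log_two_lt_d9
  norm_num at h1 h2
  constructor <;> linarith

/-- As a function of 1/r, the logarithm is convex; this is its tangent at 1/r0. -/
theorem log_ge_tangent_inv {r r0 : ℝ} (hr : 0 < r) (hr0 : 0 < r0) :
    Real.log r0 + 1 - r0 / r ≤ Real.log r := by
  have h := Real.one_sub_inv_le_log_of_pos (show 0 < r / r0 by positivity)
  rw [Real.log_div hr.ne' hr0.ne', inv_div] at h
  linarith

/-- A lower bound for `1 / v` times the rate function at distance `√v`. -/
noncomputable def rateFactor (v : ℝ) : ℝ :=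
  121 / 144 + (1 / 6 - 1 / 858) * v + v ^ 2 / 15 + v ^ 3 / 28 + v ^ 4 / 45 + v ^ 5 / 66

theorem rateFactor_mono {v w : ℝ} (hv : 0 ≤ v) (hvw : v ≤ w) : rateFactor v ≤ rateFactor w := by
  unfold rateFactor
  gcongr

theorem pow_ge_tangent {v v0 : ℝ} (hv : 0 ≤ v) (hv0 : 0 ≤ v0) (n : ℕ) :
    v0 ^ n + n * v0 ^ (n - 1) * (v - v0) ≤ v ^ n := by
  by_cases hn : n = 0
  · subst hn; simp
  have key : ∀ n : ℕ, v0 ^ (n + 1) + (n + 1) * v0 ^ n * (v - v0) ≤ v ^ (n + 1) := by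
    intro n
    induction n with
    | zero => simp
    | succ n ih =>
      have h1 := mul_le_mul_of_nonneg_left ih hv
      have h2 : 0 ≤ (n + 1 : ℝ) * v0 ^ n * (v - v0) ^ 2 := by positivity
      push_cast
      calc _ = v * (v0 ^ (n + 1) + (n + 1) * v0 ^ n * (v - v0)) -
            (n + 1 : ℝ) * v0 ^ n * (v - v0) ^ 2 := by ring
        _ ≤ v * v ^ (n + 1) := by linarith
        _ = _ := by ring
  obtain ⟨k, rfl⟩ := Nat.exists_eq_succ_of_ne_zero hn
  simpa using key k

/-- Replacing the logarithm by its tangent at r0 and the convex polynomial `2 * rateFactor v - 1` by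
its tangent at v0, with rounded coefficients a, b, c, leaves a cubic inequality in u = r0 / r. -/
theorem log_bound_of_tangents {r r0 v0 a b c l : ℝ} (hr : 0 < r) (hr0 : 0 < r0)
    (hv0 : 0 ≤ v0) (hb : 0 ≤ b) (ha0 : 0 ≤ a) (hL0 : 0 ≤ 1 + Real.log r)
    (hbv : b ≤ 2 * (1 / 6 - 1 / 858) + 4 / 15 * v0 + 3 / 14 * v0 ^ 2 + 8 / 45 * v0 ^ 3
      + 5 / 33 * v0 ^ 4)
    (hab : a ≤ 2 * rateFactor v0 - 1 - v0 * (2 * (1 / 6 - 1 / 858) + 4 / 15 * v0 +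
      3 / 14 * v0 ^ 2 + 8 / 45 * v0 ^ 3 + 5 / 33 * v0 ^ 4))
    (hc : c ≤ 2 + Real.log r0) (hcu : 0 ≤ c - r0 / r)
    (hfin : l ≤ (c - r0 / r) * (a + b * (2 * (c - r0 / r) / r0) * (r0 / r))) :
    l ≤ (1 + Real.log r) * (2 * rateFactor (2 * (1 + Real.log r) / r) - 1) := by
  set L := 1 + Real.log r with hL
  have hLc : c - r0 / r ≤ L := by linarith [log_ge_tangent_inv hr hr0]
  set v := 2 * L / r with hv
  have hv' : 0 ≤ v := by positivity
  have htan : a + b * v ≤ 2 * rateFactor v - 1 := by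
    have h2 := pow_ge_tangent hv' hv0 2
    have h3 := pow_ge_tangent hv' hv0 3
    have h4 := pow_ge_tangent hv' hv0 4
    have h5 := pow_ge_tangent hv' hv0 5
    norm_num at h2 h3 h4 h5
    have h1 := mul_le_mul_of_nonneg_right hbv hv'
    unfold rateFactor at hab ⊢
    linarith
  have hvc : (2 * (c - r0 / r) / r0) * (r0 / r) ≤ v := by
    rw [hv, show (2 * (c - r0 / r) / r0) * (r0 / r) = 2 * (c - r0 / r) / r by field_simp]
    gcongr
  refine hfin.trans (mul_le_mul hLc (le_trans ?_ htan) ?_ hL0)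
  · rw [mul_assoc]; gcongr
  · positivity

/-- Here r stands for m/d and 2(1 + log r)/r for the smallest admissible t². The hypothesis that
this is at most 1 forces r ≥ 5.3. Three intervals up to 64 are handled by tangents; beyond 64 the
constant term 121/144 of `rateFactor` is enough. -/
theorem log_24_le_mul_rateFactor {r : ℝ} (hr1 : 1 ≤ r) (hr : 2 * (1 + Real.log r) / r ≤ 1) :
    Real.log 24 ≤ (1 + Real.log r) * (2 * rateFactor (2 * (1 + Real.log r) / r) - 1) := by
  have l2 := Real.log_two_gt_d9
  have l2' := Real.log_two_lt_d9
  obtain ⟨l3, l3'⟩ := log_three_bounds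
  have h24 : Real.log 24 = 3 * Real.log 2 + Real.log 3 := by
    rw [show (24 : ℝ) = 2 ^ 3 * 3 by norm_num, Real.log_mul (by norm_num) (by norm_num),
      Real.log_pow]; norm_num
  have h6 : Real.log 6 = Real.log 2 + Real.log 3 := by
    rw [show (6 : ℝ) = 2 * 3 by norm_num, Real.log_mul (by norm_num) (by norm_num)]
  have h9 : Real.log 9 = 2 * Real.log 3 := by
    rw [show (9 : ℝ) = 3 ^ 2 by norm_num, Real.log_pow]; norm_num
  have h16 : Real.log 16 = 4 * Real.log 2 := by
    rw [show (16 : ℝ) = 2 ^ 4 by norm_num, Real.log_pow]; norm_num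
  have h64 : Real.log 64 = 6 * Real.log 2 := by
    rw [show (64 : ℝ) = 2 ^ 6 by norm_num, Real.log_pow]; norm_num
  have hr0 : 0 < r := by linarith
  have hlog : 0 ≤ Real.log r := Real.log_nonneg hr1
  have hL0 : 0 ≤ 1 + Real.log r := by linarith
  have h24' : Real.log 24 ≤ 3.1782 := by linarith
  rw [div_le_one hr0] at hr
  have h53 : 5.3 ≤ r := by
    by_contra! hlt
    have ht1 := log_ge_tangent_inv hr0 (show (0 : ℝ) < 2 by norm_num)
    have ht2 := log_ge_tangent_inv hr0 (show (0 : ℝ) < 4 by norm_num)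
    have ht3 := log_ge_tangent_inv hr0 (show (0 : ℝ) < 6 by norm_num)
    have e1 : 2 / r * r = 2 := by field_simp
    have e2 : 4 / r * r = 4 := by field_simp
    have e3 : 6 / r * r = 6 := by field_simp
    rw [show (4 : ℝ) = 2 ^ 2 by norm_num, Real.log_pow] at ht2
    norm_num at ht2
    rcases le_total r 1.8 with h | h
    · linarith
    rcases le_total r 4 with h | h
    · nlinarith
    · nlinarith
  have hu : ∀ {r0 x y : ℝ}, 0 < r0 → 0 < x → 0 < y → x ≤ r → r ≤ y →
      r0 / y ≤ r0 / r ∧ r0 / r ≤ r0 / x := fun h0 hx hy h1 h2 =>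
    ⟨div_le_div_of_nonneg_left h0.le hr0 h2, div_le_div_of_nonneg_left h0.le hx h1⟩
  rcases le_total r 7.5 with h1 | h1
  · obtain ⟨u1, u2⟩ := hu (show (0 : ℝ) < 6 by norm_num) (by norm_num) (by norm_num) h53 h1
    generalize hu6 : 6 / r = u at u1 u2
    norm_num at u1 u2
    refine log_bound_of_tangents (r0 := 6) (v0 := 0.8) (a := 0.4277) (b := 0.8345) (c := 3.7917)
      hr0 (by norm_num) (by norm_num) (by norm_num) (by norm_num) hL0 (by norm_num)
      (by norm_num [rateFactor]) (by linarith) ?_ ?_ <;> rw [hu6]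
    · linarith
    · refine h24'.trans ?_
      nlinarith [mul_nonneg (sub_nonneg.2 u1) (sub_nonneg.2 u2),
        mul_nonneg (mul_nonneg (sub_nonneg.2 u1) (sub_nonneg.2 u2)) (sub_nonneg.2 u1),
        mul_nonneg (mul_nonneg (sub_nonneg.2 u1) (sub_nonneg.2 u2)) (sub_nonneg.2 u2)]
  rcases le_total r 12 with h2 | h2
  · obtain ⟨u1, u2⟩ := hu (show (0 : ℝ) < 9 by norm_num) (by norm_num) (by norm_num) h1 h2
    generalize hu6 : 9 / r = u at u1 u2
    norm_num at u1 u2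
    refine log_bound_of_tangents (r0 := 9) (v0 := 0.6) (a := 0.5749) (b := 0.6261) (c := 4.1972)
      hr0 (by norm_num) (by norm_num) (by norm_num) (by norm_num) hL0 (by norm_num)
      (by norm_num [rateFactor]) (by linarith) ?_ ?_ <;> rw [hu6]
    · linarith
    · refine h24'.trans ?_
      nlinarith [mul_nonneg (sub_nonneg.2 u1) (sub_nonneg.2 u2),
        mul_nonneg (mul_nonneg (sub_nonneg.2 u1) (sub_nonneg.2 u2)) (sub_nonneg.2 u1),
        mul_nonneg (mul_nonneg (sub_nonneg.2 u1) (sub_nonneg.2 u2)) (sub_nonneg.2 u2)]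
  rcases le_total r 64 with h3 | h3
  · obtain ⟨u1, u2⟩ := hu (show (0 : ℝ) < 16 by norm_num) (by norm_num) (by norm_num) h2 h3
    generalize hu6 : 16 / r = u at u1 u2
    norm_num at u1 u2
    refine log_bound_of_tangents (r0 := 16) (v0 := 0.44) (a := 0.6355) (b := 0.5106) (c := 4.7725)
      hr0 (by norm_num) (by norm_num) (by norm_num) (by norm_num) hL0 (by norm_num)
      (by norm_num [rateFactor]) (by linarith) ?_ ?_ <;> rw [hu6]
    · linarith
    · refine h24'.trans ?_
      nlinarith [mul_nonneg (sub_nonneg.2 u1) (sub_nonneg.2 u2),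
        mul_nonneg (mul_nonneg (sub_nonneg.2 u1) (sub_nonneg.2 u2)) (sub_nonneg.2 u1),
        mul_nonneg (mul_nonneg (sub_nonneg.2 u1) (sub_nonneg.2 u2)) (sub_nonneg.2 u2)]
  · have h64r : Real.log 64 ≤ Real.log r := Real.log_le_log (by norm_num) h3
    have := rateFactor_mono le_rfl (show 0 ≤ 2 * (1 + Real.log r) / r by positivity)
    have h0 : rateFactor 0 = 121 / 144 := by norm_num [rateFactor]
    nlinarith

/-! ### Lower bounds for the ghost rate. -/

/-- The rate function of the ghost sample bound, for blocks of `12` points. -/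
noncomputable def ghostRate (t : ℝ) : ℝ :=
  (1 + t) * Real.log ((1 + t) / (1 + t / 12)) + (1 - t) * Real.log ((1 - t) / (1 - t / 12))

/-- This is u ≤ sinh u for u = log((1 + s)/(1 - s)). -/
theorem log_div_le_of_lt_one {s : ℝ} (h0 : 0 ≤ s) (h1 : s < 1) :
    Real.log (1 + s) - Real.log (1 - s) ≤ 2 * s / (1 - s ^ 2) := by
  have hs : 0 < 1 - s := by linarith
  have hs' : 0 < 1 + s := by linarith
  set u := Real.log (1 + s) - Real.log (1 - s) with hu
  have hu0 : 0 ≤ u := sub_nonneg.2 (Real.log_le_log hs (by linarith))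
  have h := Real.self_le_sinh_iff.2 hu0
  rw [Real.sinh_eq, hu, neg_sub, Real.exp_sub, Real.exp_sub, Real.exp_log hs, Real.exp_log hs',
    ← hu] at h
  refine h.trans (le_of_eq ?_)
  rw [show 1 - s ^ 2 = (1 - s) * (1 + s) by ring]
  field_simp
  ring

/-- The right side is t log((1 + t)/(1 − t)) + log(1 − t²). Its power series has the positive
coefficients 1/((2k + 1)(k + 1)) at t^(2k+2), so it may be cut after six terms. -/
theorem entropy_series_le {t : ℝ} (h0 : 0 < t) (h1 : t < 1) :
    t ^ 2 + t ^ 4 / 6 + t ^ 6 / 15 + t ^ 8 / 28 + t ^ 10 / 45 + t ^ 12 / 66 ≤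
      (1 + t) * Real.log (1 + t) + (1 - t) * Real.log (1 - t) := by
  have ha : |t| < 1 := by rwa [abs_of_pos h0]
  have hb : |t ^ 2| < 1 := by rw [abs_of_nonneg (sq_nonneg t)]; nlinarith
  have hs1 := (Real.hasSum_log_sub_log_of_abs_lt_one ha).mul_left t
  have hs2 := Real.hasSum_pow_div_log_of_abs_lt_one hb
  have hs := hs1.sub hs2
  have hval : t * (Real.log (1 + t) - Real.log (1 - t)) - -Real.log (1 - t ^ 2) =
      (1 + t) * Real.log (1 + t) + (1 - t) * Real.log (1 - t) := by
    rw [show 1 - t ^ 2 = (1 + t) * (1 - t) by ring,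
      Real.log_mul (by linarith) (by linarith)]
    ring
  rw [hval] at hs
  have hle := sum_le_hasSum (Finset.range 6) (fun k _ => ?_) hs
  · refine le_trans (le_of_eq ?_) hle
    simp [Finset.sum_range_succ]
    ring
  · have : t * (2 * (1 / (2 * (k : ℝ) + 1)) * t ^ (2 * k + 1)) - (t ^ 2) ^ (k + 1) / ((k : ℝ) + 1) =
        t ^ (2 * k + 2) / ((2 * k + 1) * (k + 1)) := by
      rw [← pow_mul]
      field_simp
      ring
    rw [this]
    positivity

/-- With s = t/12, the rate is the entropy series minus log(1 − s²) minus t log((1 + s)/(1 − s)).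
The corrections contribute at least t²/144 and at worst −t²/6 − t⁴/858, whence 121/144 = 1 + 1/144 −
1/6 and the coefficient 1/6 − 1/858. -/
theorem ghostRate_ge {t : ℝ} (h0 : 0 < t) (h1 : t < 1) :
    t ^ 2 * rateFactor (t ^ 2) ≤ ghostRate t := by
  have hser := entropy_series_le h0 h1
  have hs0 : 0 ≤ t / 12 := by positivity
  have hs1 : t / 12 < 1 := by linarith
  have hlog := log_div_le_of_lt_one hs0 hs1
  have hsq : Real.log (1 - (t / 12) ^ 2) ≤ - (t / 12) ^ 2 := by
    have := Real.log_le_sub_one_of_pos (show 0 < 1 - (t / 12) ^ 2 by nlinarith)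
    linarith
  have hfrac : 2 * (t / 12) / (1 - (t / 12) ^ 2) ≤ t / 6 * (1 + t ^ 2 / 143) := by
    rw [div_le_iff₀ (by nlinarith)]
    have : 0 ≤ t * (t ^ 2 * (1 - t ^ 2)) := by
      have : 0 ≤ 1 - t ^ 2 := by nlinarith
      positivity
    nlinarith
  have hE : ghostRate t = ((1 + t) * Real.log (1 + t) + (1 - t) * Real.log (1 - t)) -
      Real.log (1 - (t / 12) ^ 2) - t * (Real.log (1 + t / 12) - Real.log (1 - t / 12)) := by
    unfold ghostRate
    rw [Real.log_div (by linarith) (by linarith), Real.log_div (by linarith) (by linarith),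
      show 1 - (t / 12) ^ 2 = (1 + t / 12) * (1 - t / 12) by ring,
      Real.log_mul (by linarith) (by linarith)]
    ring
  rw [hE]
  have h3 := mul_le_mul_of_nonneg_left (hlog.trans hfrac) h0.le
  unfold rateFactor
  nlinarith

/-- The gain of the rate function over `t² / 2` pays for the ghost sample. -/
theorem mul_ghostRate_ge {m d : ℕ} (hd : 0 < d) (hdm : d ≤ m) {t : ℝ} (h0 : 0 < t) (h1 : t < 1)
    (ht : d * (1 + Real.log (m / d)) ≤ m * t ^ 2 / 2) :
    m * t ^ 2 / 2 + d * Real.log 24 ≤ m * ghostRate t := by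
  have hd0 : (0 : ℝ) < d := by exact_mod_cast hd
  have hm0 : (0 : ℝ) < m := by exact_mod_cast hd.trans_le hdm
  have hr1 : (1 : ℝ) ≤ m / d := by rw [one_le_div hd0]; exact_mod_cast hdm
  set r : ℝ := m / d with hr
  have hm : (m : ℝ) = d * r := by rw [hr]; field_simp
  have hr0 : 0 < r := by linarith
  set L := 1 + Real.log r with hL
  have hL0 : 0 ≤ L := by have := Real.log_nonneg hr1; linarith
  have hLt : 2 * L ≤ r * t ^ 2 := by
    rw [hm] at ht
    have : d * L ≤ d * (r * t ^ 2 / 2) := by linarith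
    have := le_of_mul_le_mul_left this hd0
    linarith
  have hv : 2 * L / r ≤ t ^ 2 := by rw [div_le_iff₀ hr0]; linarith
  have ht1 : t ^ 2 ≤ 1 := by nlinarith
  have hlog := log_24_le_mul_rateFactor hr1 (hv.trans ht1)
  rw [← hL] at hlog
  have hmono := rateFactor_mono (show 0 ≤ 2 * L / r by positivity) hv
  have h0' : rateFactor 0 = 121 / 144 := by norm_num [rateFactor]
  have hbase := rateFactor_mono le_rfl (show 0 ≤ 2 * L / r by positivity)
  have hg := ghostRate_ge h0 h1
  -- Both factors on the right increase with t², so the worst case is the smallest admissible t²,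
  -- namely 2L/r.
  have hfin : Real.log 24 ≤ r * t ^ 2 / 2 * (2 * rateFactor (t ^ 2) - 1) := by
    refine hlog.trans (mul_le_mul (by linarith) (by linarith) (by linarith) (by positivity))
  have hfin' : Real.log 24 ≤ r * ghostRate t - r * t ^ 2 / 2 := by
    have := mul_le_mul_of_nonneg_left hg hr0.le
    nlinarith
  rw [hm]
  have := mul_le_mul_of_nonneg_left hfin' hd0.le
  nlinarith

/-! ### Weighted label sums and their measurability. -/

/-- The weighted number of positive labels. -/
noncomputable def labelSum {J : Type*} [Fintype J] (w : J → ℝ) (p : J → Bool) : ℝ :=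
  ∑ j, w j * (if p j = true then 1 else 0)

/-- The supremum over the class of the absolute weighted number of positive labels. -/
noncomputable def labelSup {X J : Type*} [Fintype J] (H : Set (X → Bool)) (w : J → ℝ)
    (z : J → X) : ℝ :=
  ⨆ h : H, |labelSum w fun j => (h : X → Bool) (z j)|

theorem abs_labelSum_le {J : Type*} [Fintype J] (w : J → ℝ) (p : J → Bool) :
    |labelSum w p| ≤ ∑ j, |w j| := by
  refine (Finset.abs_sum_le_sum_abs _ _).trans (Finset.sum_le_sum fun j _ => ?_)
  split_ifs <;> simp

theorem bddAbove_labelSum {X J : Type*} [Fintype J] (H : Set (X → Bool)) (w : J → ℝ)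
    (z : J → X) :
    BddAbove (Set.range fun h : H => |labelSum w fun j => (h : X → Bool) (z j)|) :=
  ⟨∑ j, |w j|, by rintro _ ⟨h, rfl⟩; exact abs_labelSum_le _ _⟩

theorem labelSum_le_labelSup {X J : Type*} [Fintype J] {H : Set (X → Bool)} (w : J → ℝ)
    (z : J → X) {h : X → Bool} (hh : h ∈ H) :
    |labelSum w fun j => h (z j)| ≤ labelSup H w z :=
  le_ciSup (bddAbove_labelSum H w z) (⟨h, hh⟩ : H)

theorem pi_map_comp_equiv {X J J' : Type*} [MeasurableSpace X] [Fintype J] [Fintype J']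
    (P : J' → Measure X) [∀ j, SigmaFinite (P j)] (e : J ≃ J') :
    MeasurePreserving (fun (z : J' → X) (j : J) => z (e j)) (Measure.pi P)
      (Measure.pi fun j => P (e j)) := by
  have hmeas : Measurable fun (z : J' → X) (j : J) => z (e j) := by fun_prop
  refine ⟨hmeas, (Measure.pi_eq fun s hs => ?_).symm⟩
  rw [Measure.map_apply hmeas (MeasurableSet.univ_pi hs)]
  have : (fun (z : J' → X) (j : J) => z (e j)) ⁻¹' Set.univ.pi s =
      Set.univ.pi fun j => s (e.symm j) := by
    ext z
    simp only [Set.mem_preimage, Set.mem_pi, Set.mem_univ, true_implies]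
    exact ⟨fun h j => by simpa using h (e.symm j), fun h j => by simpa using h (e j)⟩
  rw [this, Measure.pi_pi, ← Equiv.prod_comp e]
  simp

/-- The measurable class condition enters through this lemma alone. Arbitrary weights are needed
because it serves both the samples, with weights ±1/m, and the mixture of real and ghost points. -/
theorem IsMeasurableClass.aemeasurable_labelSup {X J : Type*} [MeasurableSpace X] [Fintype J]
    {H : Set (X → Bool)} {D : Set (Measure X)} (hreg : IsMeasurableClass H D)
    (P : J → Measure X) [∀ j, SigmaFinite (P j)] (hP : ∀ j, P j ∈ D) (w : J → ℝ) :
    AEMeasurable (labelSup H w) (Measure.pi P) := by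
  let e := (Fintype.equivFin J).symm
  have h := hreg _ (fun j => P (e j)) (fun j => hP _) fun j => w (e j)
  have h' := h.comp_quasiMeasurePreserving (pi_map_comp_equiv P e).quasiMeasurePreserving
  refine h'.congr (Filter.Eventually.of_forall fun z => ?_)
  simp only [Function.comp_def, labelSup, labelSum]
  congr 1
  funext h
  rw [← Equiv.sum_comp e]

/-! ### Ghost blocks and exponential moments under random exchanges. -/

/-- Real points together with their ghost points. -/
def mergeGhost {X ι κ : Type*} (p : (ι → X) × (ι × κ → X)) (j : ι × Option κ) : X :=
  j.2.elim (p.1 j.1) fun l => p.2 (j.1, l)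

theorem measurePreserving_mergeGhost {X ι κ : Type*} [MeasurableSpace X] [Fintype ι] [Fintype κ]
    (Q : ι → Measure X) [∀ j, SigmaFinite (Q j)] :
    MeasurePreserving (mergeGhost (X := X) (ι := ι) (κ := κ))
      ((Measure.pi Q).prod (Measure.pi fun j : ι × κ => Q j.1))
      (Measure.pi fun j : ι × Option κ => Q j.1) := by
  have hmeas : Measurable (mergeGhost (X := X) (ι := ι) (κ := κ)) := by
    refine measurable_pi_lambda _ ?_
    rintro ⟨i, _ | l⟩ <;> simp only [mergeGhost, Option.elim] <;> fun_prop
  refine ⟨hmeas, (Measure.pi_eq fun s hs => ?_).symm⟩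
  rw [Measure.map_apply hmeas (MeasurableSet.univ_pi hs)]
  have : mergeGhost ⁻¹' Set.univ.pi s =
      (Set.univ.pi fun i : ι => s (i, none)) ×ˢ (Set.univ.pi fun j : ι × κ => s (j.1, some j.2)) := by
    ext ⟨x, g⟩
    simp only [Set.mem_preimage, Set.mem_pi, Set.mem_univ, true_implies, Set.mem_prod]
    constructor
    · exact fun h => ⟨fun i => h (i, none), fun j => h (j.1, some j.2)⟩
    · rintro ⟨h1, h2⟩ ⟨i, _ | l⟩
      · exact h1 i
      · exact h2 (i, l)
  rw [this, Measure.prod_prod, Measure.pi_pi, Measure.pi_pi, Fintype.prod_prod_type,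
    Fintype.prod_prod_type, ← Finset.prod_mul_distrib]
  simp [Fintype.prod_option]

/-- The weights `± α` of a real point and `∓ η` of its ghost points. -/
def ghostWeight {ι κ : Type*} (ε : ι → ℝ) (α η : ℝ) (j : ι × Option κ) : ℝ :=
  j.2.elim (ε j.1 * α) fun _ => -(ε j.1 * η)

/-- Exchange, in each block, the real point with a prescribed point of the block. -/
def blockSwap {ι κ : Type*} [DecidableEq κ] (σ : ι → Option κ) :
    ι × Option κ ≃ ι × Option κ where
  toFun j := (j.1, Equiv.swap none (σ j.1) j.2)
  invFun j := (j.1, Equiv.swap none (σ j.1) j.2)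
  left_inv j := by simp
  right_inv j := by simp

/-- In a block, α on the chosen point and −η on the others is α + η on the chosen point and −η on
all. Only the first part depends on σ, so the blocks decouple. -/
theorem labelSum_ghostWeight_blockSwap {ι κ : Type*} [Fintype ι] [Fintype κ] [DecidableEq κ]
    (ε : ι → ℝ) (α η : ℝ) (σ : ι → Option κ) (p : ι × Option κ → Bool) :
    labelSum (ghostWeight ε α η) (fun j => p (blockSwap σ j)) =
      ∑ i, ε i * ((α + η) * (if p (i, σ i) = true then 1 else 0) -
        η * ∑ o, if p (i, o) = true then 1 else 0) := by
  unfold labelSum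
  rw [Fintype.sum_prod_type]
  refine Finset.sum_congr rfl fun i _ => ?_
  rw [← Equiv.sum_comp (Equiv.swap none (σ i)) fun o => if p (i, o) = true then (1 : ℝ) else 0]
  simp only [Fintype.sum_option, blockSwap, Equiv.coe_fn_mk, ghostWeight, Option.elim,
    Equiv.swap_apply_left, Finset.mul_sum, mul_add]
  rw [mul_sub, mul_add, Finset.mul_sum]
  simp only [neg_mul, Finset.sum_neg_distrib, mul_assoc]
  ring_nf
  rfl

/-- Labels are 0 or 1, so the exponential is affine in the label of the chosen point, and the block
average depends only on the frequency y of positive labels. -/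
theorem sum_exp_block_le {κ : Type*} [Fintype κ] {α η Φ : ℝ}
    (hΦ : ∀ y ∈ Set.Icc (0 : ℝ) 1, Real.exp (-(η * (Fintype.card κ + 1) * y)) *
      (1 + y * (Real.exp (α + η) - 1)) ≤ Φ) (p : Option κ → Bool) :
    ∑ o, Real.exp ((α + η) * (if p o = true then 1 else 0) -
        η * ∑ o, if p o = true then 1 else 0) ≤ (Fintype.card κ + 1) * Φ := by
  set q : ℝ := ∑ o, if p o = true then (1 : ℝ) else 0 with hq
  have hn : (0 : ℝ) < Fintype.card κ + 1 := by positivity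
  have hq0 : 0 ≤ q := by rw [hq]; exact Finset.sum_nonneg fun o _ => by split_ifs <;> norm_num
  have hq1 : q ≤ Fintype.card κ + 1 := by
    calc q ≤ ∑ _o : Option κ, (1 : ℝ) := by
          rw [hq]; exact Finset.sum_le_sum fun o _ => by split_ifs <;> norm_num
      _ = _ := by simp
  have h := hΦ (q / (Fintype.card κ + 1)) ⟨by positivity, (div_le_one hn).2 hq1⟩
  have hterm : ∀ o, Real.exp ((α + η) * (if p o = true then 1 else 0) - η * q) =
      Real.exp (-(η * q)) * (1 + (if p o = true then 1 else 0) * (Real.exp (α + η) - 1)) := by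
    intro o
    split_ifs
    · rw [← mul_comm, show (1 : ℝ) + 1 * (Real.exp (α + η) - 1) = Real.exp (α + η) by ring,
        ← Real.exp_add]
      ring_nf
    · simp
  simp only [hterm]
  rw [← Finset.mul_sum, Finset.sum_add_distrib,
    ← Finset.sum_mul, ← hq]
  calc _ = (Fintype.card κ + 1) * (Real.exp (-(η * (Fintype.card κ + 1) *
        (q / (Fintype.card κ + 1)))) * (1 + q / (Fintype.card κ + 1) *
          (Real.exp (α + η) - 1))) := by
        rw [show η * ((Fintype.card κ : ℝ) + 1) * (q / (Fintype.card κ + 1)) = η * q by field_simp]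
        simp only [Finset.sum_const, Finset.card_univ, Fintype.card_option, nsmul_eq_mul, mul_one]
        push_cast
        field_simp
    _ ≤ _ := mul_le_mul_of_nonneg_left h hn.le

/-- Exchanging the labels 0 and 1 turns the negative tilt into the positive one, up to the constant
factor exp(−(α − η|κ|)). -/
theorem sum_exp_neg_block_le {κ : Type*} [Fintype κ] {α η Φ : ℝ}
    (hΦ : ∀ y ∈ Set.Icc (0 : ℝ) 1, Real.exp (-(η * (Fintype.card κ + 1) * y)) *
      (1 + y * (Real.exp (α + η) - 1)) ≤ Φ) (p : Option κ → Bool) :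
    ∑ o, Real.exp (-((α + η) * (if p o = true then 1 else 0) -
        η * ∑ o, if p o = true then 1 else 0)) ≤
      (Fintype.card κ + 1) * (Real.exp (-(α - η * Fintype.card κ)) * Φ) := by
  have h := sum_exp_block_le hΦ fun o => !p o
  have hflip : ∀ o, (if (!p o) = true then (1 : ℝ) else 0) = 1 - if p o = true then 1 else 0 := by
    intro o; cases p o <;> simp
  simp only [hflip, Finset.sum_sub_distrib, Finset.sum_const, Finset.card_univ,
    Fintype.card_option, nsmul_eq_mul, mul_one] at h
  push_cast at h
  set q : ℝ := ∑ o, if p o = true then (1 : ℝ) else 0 with hq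
  have hterm : ∀ o, Real.exp (-((α + η) * (if p o = true then 1 else 0) - η * q)) =
      Real.exp (-(α - η * Fintype.card κ)) * Real.exp ((α + η) *
        (1 - if p o = true then 1 else 0) - η * (Fintype.card κ + 1 - q)) := by
    intro o
    rw [← Real.exp_add]
    congr 1
    ring
  simp only [hterm]
  rw [← Finset.mul_sum]
  calc _ ≤ Real.exp (-(α - η * Fintype.card κ)) * ((Fintype.card κ + 1) * Φ) :=
        mul_le_mul_of_nonneg_left h (Real.exp_pos _).le
    _ = _ := by ring

/-- The sign `1` on the first sample and `-1` on the second one. -/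
def sampleSign {m : ℕ} (i : Bool × Fin m) : ℝ := if i.1 = true then 1 else -1

/-- Bound e^|x| by e^x + e^{-x}. For either sign the sum over σ is a product of block sums, m of
them tilted positively and m negatively. -/
theorem sum_exp_labelSum_le {κ : Type*} [Fintype κ] [DecidableEq κ] {m : ℕ} {α η Φ : ℝ}
    (hΦ : ∀ y ∈ Set.Icc (0 : ℝ) 1, Real.exp (-(η * (Fintype.card κ + 1) * y)) *
      (1 + y * (Real.exp (α + η) - 1)) ≤ Φ) (p : (Bool × Fin m) × Option κ → Bool) :
    ∑ σ : Bool × Fin m → Option κ,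
        Real.exp |labelSum (ghostWeight sampleSign α η) fun j => p (blockSwap σ j)| ≤
      Fintype.card (Bool × Fin m → Option κ) *
        (2 * (Φ ^ 2 * Real.exp (-(α - η * Fintype.card κ))) ^ m) := by
  have hΦ0 : 0 ≤ Φ := by
    have := hΦ 0 ⟨le_rfl, zero_le_one⟩
    simp at this
    linarith
  have habs : ∀ x : ℝ, Real.exp |x| ≤ Real.exp x + Real.exp (-x) := by
    intro x
    rcases abs_cases x with ⟨h, _⟩ | ⟨h, _⟩ <;> rw [h] <;>
      linarith [Real.exp_pos x, Real.exp_pos (-x)]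
  have hprod : ∀ e : ℝ, e = 1 ∨ e = -1 → ∑ σ : Bool × Fin m → Option κ,
        Real.exp (e * labelSum (ghostWeight sampleSign α η) fun j => p (blockSwap σ j)) ≤
      ((Fintype.card κ + 1) * Φ) ^ m *
        ((Fintype.card κ + 1) * (Real.exp (-(α - η * Fintype.card κ)) * Φ)) ^ m := by
    intro e he
    have h1 : ∀ σ : Bool × Fin m → Option κ,
        Real.exp (e * labelSum (ghostWeight sampleSign α η) fun j => p (blockSwap σ j)) =
        ∏ i, Real.exp (e * (sampleSign i * ((α + η) * (if p (i, σ i) = true then 1 else 0) -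
          η * ∑ o, if p (i, o) = true then 1 else 0))) := by
      intro σ
      rw [labelSum_ghostWeight_blockSwap, Finset.mul_sum, Real.exp_sum]
    rw [Finset.sum_congr rfl fun σ _ => h1 σ, ← Fintype.prod_sum fun (i : Bool × Fin m) o =>
      Real.exp (e * (sampleSign i * ((α + η) * (if p (i, o) = true then 1 else 0) -
          η * ∑ o, if p (i, o) = true then 1 else 0)))]
    rw [Fintype.prod_prod_type, Fintype.prod_bool]
    have hpos : ∀ i, ∑ o, Real.exp (1 * ((α + η) * (if p (i, o) = true then 1 else 0) -
          η * ∑ o, if p (i, o) = true then 1 else 0)) ≤ (Fintype.card κ + 1) * Φ := by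
      intro i
      simpa only [one_mul] using sum_exp_block_le hΦ fun o => p (i, o)
    have hneg : ∀ i, ∑ o, Real.exp (-1 * ((α + η) * (if p (i, o) = true then 1 else 0) -
          η * ∑ o, if p (i, o) = true then 1 else 0)) ≤
          (Fintype.card κ + 1) * (Real.exp (-(α - η * Fintype.card κ)) * Φ) := by
      intro i
      simpa only [neg_one_mul] using sum_exp_neg_block_le hΦ fun o => p (i, o)
    have key : ∀ (f : Fin m → ℝ) (C : ℝ), (∀ j, 0 ≤ f j) → (∀ j, f j ≤ C) →
        ∏ j, f j ≤ C ^ m := by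
      intro f C h0 hC
      simpa using Finset.prod_le_prod (s := Finset.univ) (fun j _ => h0 j) fun j _ => hC j
    rcases he with rfl | rfl
    · refine mul_le_mul (key _ _ (fun j => Finset.sum_nonneg fun o _ => (Real.exp_pos _).le)
        fun j => ?_) (key _ _ (fun j => Finset.sum_nonneg fun o _ => (Real.exp_pos _).le)
        fun j => ?_) (Finset.prod_nonneg fun j _ => Finset.sum_nonneg fun o _ =>
          (Real.exp_pos _).le) (by positivity)
      · simpa [sampleSign] using hpos (true, j)
      · simpa [sampleSign] using hneg (false, j)
    · rw [mul_comm]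
      refine mul_le_mul (key _ _ (fun j => Finset.sum_nonneg fun o _ => (Real.exp_pos _).le)
        fun j => ?_) (key _ _ (fun j => Finset.sum_nonneg fun o _ => (Real.exp_pos _).le)
        fun j => ?_) (Finset.prod_nonneg fun j _ => Finset.sum_nonneg fun o _ =>
          (Real.exp_pos _).le) (by positivity)
      · simpa [sampleSign] using hpos (false, j)
      · simpa [sampleSign] using hneg (true, j)
  have hcard : (Fintype.card (Bool × Fin m → Option κ) : ℝ) =
      (Fintype.card κ + 1) ^ m * (Fintype.card κ + 1) ^ m := by
    simp [← pow_add, two_mul]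
  calc _ ≤ ∑ σ : Bool × Fin m → Option κ,
        (Real.exp (1 * labelSum (ghostWeight sampleSign α η) fun j => p (blockSwap σ j)) +
        Real.exp (-1 * labelSum (ghostWeight sampleSign α η) fun j => p (blockSwap σ j))) :=
        Finset.sum_le_sum fun σ _ => by
          simpa only [one_mul, neg_one_mul] using habs _
    _ ≤ _ := by
        rw [Finset.sum_add_distrib]
        refine (add_le_add (hprod 1 (Or.inl rfl)) (hprod (-1) (Or.inr rfl))).trans (le_of_eq ?_)
        rw [hcard, mul_pow, mul_pow, mul_pow, mul_pow, ← pow_mul, mul_comm 2 m, pow_mul]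
        ring

/-- The exponential of the supremum is at most the sum over all labellings of the full set of
points. This set of labellings does not depend on σ, so Sauer's bound is paid once. -/
theorem sum_exp_labelSup_le {X κ : Type*} [Fintype κ] [DecidableEq κ] {m d : ℕ} {α η Φ : ℝ}
    (hΦ : ∀ y ∈ Set.Icc (0 : ℝ) 1, Real.exp (-(η * (Fintype.card κ + 1) * y)) *
      (1 + y * (Real.exp (α + η) - 1)) ≤ Φ) {H : Set (X → Bool)} (hne : H.Nonempty)
    (hVC : HasVCDim H d) (z : (Bool × Fin m) × Option κ → X) :
    ∑ σ : Bool × Fin m → Option κ,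
        Real.exp (labelSup H (ghostWeight sampleSign α η) fun j => z (blockSwap σ j)) ≤
      Fintype.card (Bool × Fin m → Option κ) *
        ((∑ i ∈ Finset.Iic d, (2 * m * (Fintype.card κ + 1)).choose i : ℕ) *
          (2 * (Φ ^ 2 * Real.exp (-(α - η * Fintype.card κ))) ^ m)) := by
  classical
  have := hne.to_subtype
  set P : Set ((Bool × Fin m) × Option κ → Bool) := (fun (h : X → Bool) i => h (z i)) '' H with hP
  have hcard := hVC.card_labellings_le z
  rw [← hP, Nat.card_coe_set_eq, Set.ncard_eq_toFinset_card P P.toFinite] at hcard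
  have hJ : Fintype.card ((Bool × Fin m) × Option κ) = 2 * m * (Fintype.card κ + 1) := by simp
  rw [hJ] at hcard
  have hσ : ∀ σ : Bool × Fin m → Option κ,
      Real.exp (labelSup H (ghostWeight sampleSign α η) fun j => z (blockSwap σ j)) ≤
      ∑ p ∈ P.toFinite.toFinset,
        Real.exp |labelSum (ghostWeight sampleSign α η) fun j => p (blockSwap σ j)| := by
    intro σ
    have hle : ∀ h : H, Real.exp |labelSum (ghostWeight sampleSign α η)
        fun j => (h : X → Bool) (z (blockSwap σ j))| ≤ ∑ p ∈ P.toFinite.toFinset,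
        Real.exp |labelSum (ghostWeight sampleSign α η) fun j => p (blockSwap σ j)| := by
      intro h
      exact Finset.single_le_sum (f := fun p : (Bool × Fin m) × Option κ → Bool =>
        Real.exp |labelSum (ghostWeight sampleSign α η) fun j => p (blockSwap σ j)|)
        (fun p _ => (Real.exp_pos _).le)
        ((Set.Finite.mem_toFinset _).2 (Set.mem_image_of_mem (fun (h : X → Bool) i => h (z i)) h.2))
    have hpos : 0 < ∑ p ∈ P.toFinite.toFinset,
        Real.exp |labelSum (ghostWeight sampleSign α η) fun j => p (blockSwap σ j)| :=
      (Real.exp_pos _).trans_le (hle (Classical.arbitrary H))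
    rw [← Real.le_log_iff_exp_le hpos]
    exact ciSup_le fun h => (Real.le_log_iff_exp_le hpos).2 (hle h)
  refine (Finset.sum_le_sum fun σ _ => hσ σ).trans ?_
  rw [Finset.sum_comm]
  refine (Finset.sum_le_sum fun p _ => sum_exp_labelSum_le hΦ p).trans ?_
  rw [Finset.sum_const, nsmul_eq_mul]
  have h0 : 0 ≤ 2 * (Φ ^ 2 * Real.exp (-(α - η * Fintype.card κ))) ^ m := by positivity
  have hc : ((P.toFinite.toFinset.card : ℕ) : ℝ) ≤
      (∑ i ∈ Finset.Iic d, (2 * m * (Fintype.card κ + 1)).choose i : ℕ) := by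
    exact_mod_cast hcard
  calc _ = (Fintype.card (Bool × Fin m → Option κ) : ℝ) * ((P.toFinite.toFinset.card : ℕ) *
        (2 * (Φ ^ 2 * Real.exp (-(α - η * Fintype.card κ))) ^ m)) := by ring
    _ ≤ _ := by gcongr

/-- All points of a block have the same law, so every exchange preserves the product measure and the
integral equals its average over σ. -/
theorem lintegral_exp_labelSup_le {X κ : Type*} [MeasurableSpace X] [Fintype κ] [DecidableEq κ]
    {m d : ℕ} {α η Φ : ℝ}
    (hΦ : ∀ y ∈ Set.Icc (0 : ℝ) 1, Real.exp (-(η * (Fintype.card κ + 1) * y)) *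
      (1 + y * (Real.exp (α + η) - 1)) ≤ Φ) {H : Set (X → Bool)} (hne : H.Nonempty)
    (hVC : HasVCDim H d) {D : Set (Measure X)} (hreg : IsMeasurableClass H D)
    (Q : Bool × Fin m → Measure X) [∀ i, IsProbabilityMeasure (Q i)] (hQ : ∀ i, Q i ∈ D) :
    ∫⁻ z, ENNReal.ofReal (Real.exp (labelSup H (ghostWeight sampleSign α η) z))
        ∂Measure.pi (fun j : (Bool × Fin m) × Option κ => Q j.1) ≤
      ENNReal.ofReal ((∑ i ∈ Finset.Iic d, (2 * m * (Fintype.card κ + 1)).choose i : ℕ) *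
          (2 * (Φ ^ 2 * Real.exp (-(α - η * Fintype.card κ))) ^ m)) := by
  set F : ((Bool × Fin m) × Option κ → X) → ℝ≥0∞ := fun z =>
    ENNReal.ofReal (Real.exp (labelSup H (ghostWeight sampleSign α η) z)) with hF
  set N := Fintype.card (Bool × Fin m → Option κ) with hN
  have hN0 : (N : ℝ≥0∞) ≠ 0 := by
    simp only [hN, ne_eq, Nat.cast_eq_zero]
    exact Fintype.card_ne_zero
  have hFm : AEMeasurable F (Measure.pi fun j : (Bool × Fin m) × Option κ => Q j.1) :=
    (Real.measurable_exp.comp_aemeasurable (hreg.aemeasurable_labelSup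
      (fun j : (Bool × Fin m) × Option κ => Q j.1) (fun j => hQ _) _)).ennreal_ofReal
  have hmp : ∀ σ : Bool × Fin m → Option κ, MeasurePreserving
      (fun (z : (Bool × Fin m) × Option κ → X) j => z (blockSwap σ j))
      (Measure.pi fun j : (Bool × Fin m) × Option κ => Q j.1)
      (Measure.pi fun j : (Bool × Fin m) × Option κ => Q j.1) := fun σ =>
    pi_map_comp_equiv (fun j : (Bool × Fin m) × Option κ => Q j.1) (blockSwap σ)
  have hσ : ∀ σ : Bool × Fin m → Option κ,
      ∫⁻ z, F (fun j => z (blockSwap σ j)) ∂Measure.pi (fun j : (Bool × Fin m) × Option κ => Q j.1)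
      = ∫⁻ z, F z ∂Measure.pi (fun j : (Bool × Fin m) × Option κ => Q j.1) := by
    intro σ
    have h := lintegral_map' (f := F) (g := fun (z : (Bool × Fin m) × Option κ → X) j =>
      z (blockSwap σ j)) (by rw [(hmp σ).map_eq]; exact hFm) (hmp σ).measurable.aemeasurable
    rw [(hmp σ).map_eq] at h
    exact h.symm
  have hsum : (N : ℝ≥0∞) * ∫⁻ z, F z ∂Measure.pi (fun j : (Bool × Fin m) × Option κ => Q j.1) ≤
      N * ENNReal.ofReal ((∑ i ∈ Finset.Iic d, (2 * m * (Fintype.card κ + 1)).choose i : ℕ) *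
          (2 * (Φ ^ 2 * Real.exp (-(α - η * Fintype.card κ))) ^ m)) := by
    calc _ = ∑ σ : Bool × Fin m → Option κ, ∫⁻ z, F (fun j => z (blockSwap σ j))
            ∂Measure.pi (fun j : (Bool × Fin m) × Option κ => Q j.1) := by
          rw [Finset.sum_congr rfl fun σ _ => hσ σ]
          simp [hN]
      _ = ∫⁻ z, ∑ σ : Bool × Fin m → Option κ, F (fun j => z (blockSwap σ j))
            ∂Measure.pi (fun j : (Bool × Fin m) × Option κ => Q j.1) :=
          (lintegral_finsetSum' _ fun σ _ =>
            hFm.comp_quasiMeasurePreserving (hmp σ).quasiMeasurePreserving).symm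
      _ ≤ ∫⁻ _z, N * ENNReal.ofReal ((∑ i ∈ Finset.Iic d,
            (2 * m * (Fintype.card κ + 1)).choose i : ℕ) *
            (2 * (Φ ^ 2 * Real.exp (-(α - η * Fintype.card κ))) ^ m))
            ∂Measure.pi (fun j : (Bool × Fin m) × Option κ => Q j.1) := by
          refine lintegral_mono fun z => ?_
          rw [← ENNReal.ofReal_sum_of_nonneg fun σ _ => (Real.exp_pos _).le,
            ← ENNReal.ofReal_natCast, ← ENNReal.ofReal_mul (Nat.cast_nonneg _)]
          exact ENNReal.ofReal_le_ofReal (sum_exp_labelSup_le hΦ hne hVC z)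
      _ = _ := by simp
  exact (ENNReal.mul_le_mul_iff_right hN0 (ENNReal.natCast_ne_top _)).1 hsum

/-! ### Integrating out the ghosts. -/

theorem integral_labelSum {X J : Type*} [MeasurableSpace X] [Fintype J] (P : J → Measure X)
    [∀ j, IsProbabilityMeasure (P j)] (w : J → ℝ) {h : X → Bool} (hh : Measurable h) :
    ∫ g, labelSum w (fun j => h (g j)) ∂Measure.pi P =
      ∑ j, w j * (P j).real (h ⁻¹' {true}) := by
  have hset : MeasurableSet (h ⁻¹' {true}) := hh (measurableSet_singleton _)
  have hind : ∀ x, (if h x = true then (1 : ℝ) else 0) = (h ⁻¹' {true}).indicator 1 x := by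
    intro x
    by_cases hx : h x = true
    · rw [if_pos hx, Set.indicator_of_mem (show x ∈ h ⁻¹' {true} from hx)]; rfl
    · rw [if_neg hx, Set.indicator_of_notMem (show x ∉ h ⁻¹' {true} from hx)]
  unfold labelSum
  simp only [hind]
  have hmeas : ∀ j, MeasurableSet ((fun g : J → X => g j) ⁻¹' (h ⁻¹' {true})) := fun j =>
    measurable_pi_apply j hset
  have heq : ∀ j (g : J → X), (h ⁻¹' {true}).indicator (1 : X → ℝ) (g j) =
      ((fun g : J → X => g j) ⁻¹' (h ⁻¹' {true})).indicator 1 g := fun j g => rfl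
  simp only [heq]
  rw [integral_finsetSum _ fun j _ => ((integrable_const 1).indicator (hmeas j)).const_mul _]
  refine Finset.sum_congr rfl fun j _ => ?_
  rw [integral_const_mul, integral_indicator_one (hmeas j)]
  congr 1
  exact (measurePreserving_eval P j).measureReal_preimage hset.nullMeasurableSet

theorem measurable_labelSum {X J : Type*} [MeasurableSpace X] [Fintype J] (w : J → ℝ)
    {h : X → Bool} (hh : Measurable h) :
    Measurable fun g : J → X => labelSum w fun j => h (g j) := by
  have hm : Measurable fun b : Bool => if b = true then (1 : ℝ) else 0 := measurable_of_finite _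
  unfold labelSum
  exact Finset.measurable_sum _ fun j _ => (hm.comp (hh.comp (measurable_pi_apply j))).const_mul _

/-- Jensen's inequality for exp, applied to f or to −f according to the sign of the integral. -/
theorem exp_abs_integral_le_lintegral {Ω : Type*} [MeasurableSpace Ω] (μ : Measure Ω)
    [IsProbabilityMeasure μ] {f : Ω → ℝ} (hf : Measurable f) {C : ℝ} (hC : ∀ x, |f x| ≤ C) :
    ENNReal.ofReal (Real.exp |∫ x, f x ∂μ|) ≤ ∫⁻ x, ENNReal.ofReal (Real.exp |f x|) ∂μ := by
  have key : ∀ g : Ω → ℝ, Measurable g → (∀ x, |g x| = |f x|) →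
      ENNReal.ofReal (Real.exp (∫ x, g x ∂μ)) ≤ ∫⁻ x, ENNReal.ofReal (Real.exp |f x|) ∂μ := by
    intro g hg hgf
    have hgC : ∀ x, |g x| ≤ C := fun x => (hgf x).trans_le (hC x)
    have hi : Integrable g μ := Integrable.of_bound hg.aestronglyMeasurable C
      (Filter.Eventually.of_forall hgC)
    have hie : Integrable (fun x => Real.exp (g x)) μ :=
      Integrable.of_bound hg.exp.aestronglyMeasurable (Real.exp C)
        (Filter.Eventually.of_forall fun x => by
          rw [Real.norm_eq_abs, abs_of_pos (Real.exp_pos _)]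
          exact Real.exp_le_exp.2 ((le_abs_self _).trans (hgC x)))
    have hJ := convexOn_exp.map_integral_le Real.continuous_exp.continuousOn isClosed_univ
      (Filter.Eventually.of_forall fun x => Set.mem_univ (g x)) hi hie
    refine (ENNReal.ofReal_le_ofReal hJ).trans ?_
    rw [ofReal_integral_eq_lintegral_ofReal hie
      (Filter.Eventually.of_forall fun x => (Real.exp_pos _).le)]
    refine lintegral_mono fun x => ENNReal.ofReal_le_ofReal (Real.exp_le_exp.2 ?_)
    rw [← hgf x]
    exact le_abs_self _
  rcases abs_cases (∫ x, f x ∂μ) with ⟨h, _⟩ | ⟨h, _⟩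
  · rw [h]
    exact key f hf fun _ => rfl
  · rw [h, ← integral_neg]
    exact key (fun x => -f x) hf.neg fun x => abs_neg _

theorem labelSum_mergeGhost {X ι κ : Type*} [Fintype ι] [Fintype κ] (ε : ι → ℝ) (α η : ℝ)
    (h : X → Bool) (x : ι → X) (g : ι × κ → X) :
    labelSum (ghostWeight ε α η) (fun j => h (mergeGhost (x, g) j)) =
      labelSum (fun i => ε i * α) (fun i => h (x i)) +
        labelSum (fun j : ι × κ => -(ε j.1 * η)) (fun j => h (g j)) := by
  unfold labelSum
  rw [Fintype.sum_prod_type, Fintype.sum_prod_type, ← Finset.sum_add_distrib]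
  simp only [Fintype.sum_option, ghostWeight, mergeGhost, Option.elim]
  rfl

/-- The two-sample deviation bound by ghost samples of `Fintype.card κ` points for each point. -/
theorem measure_labelSup_ge_le {X κ : Type*} [MeasurableSpace X] [Fintype κ] [DecidableEq κ]
    {m d : ℕ} {α η Φ t Δ : ℝ} (hη : 0 ≤ η) (hαη : η * Fintype.card κ ≤ α)
    (hΦ : ∀ y ∈ Set.Icc (0 : ℝ) 1, Real.exp (-(η * (Fintype.card κ + 1) * y)) *
      (1 + y * (Real.exp (α + η) - 1)) ≤ Φ) {H : Set (X → Bool)} (hne : H.Nonempty)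
    (hH : ∀ h ∈ H, Measurable h)
    (hVC : HasVCDim H d) {D : Set (Measure X)} (hreg : IsMeasurableClass H D)
    (P : Bool → Measure X) [∀ i, IsProbabilityMeasure (P i)] (hP : ∀ i, P i ∈ D)
    (hΔ0 : 0 ≤ Δ)
    (hΔ : ∀ h ∈ H, |(P true).real (h ⁻¹' {true}) - (P false).real (h ⁻¹' {true})| ≤ Δ) :
    Measure.pi (fun i : Bool × Fin m => P i.1)
        {x | α * m * (Δ + t) ≤ labelSup H (fun i => sampleSign i * α) x} ≤
      ENNReal.ofReal ((∑ i ∈ Finset.Iic d, (2 * m * (Fintype.card κ + 1)).choose i : ℕ) *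
          (2 * (Φ ^ 2 * Real.exp (-(α - η * Fintype.card κ))) ^ m) * Real.exp (-(α * m * t))) := by
  have := hne.to_subtype
  set Q : Bool × Fin m → Measure X := fun i => P i.1 with hQ
  set F : ((Bool × Fin m) × Option κ → X) → ℝ≥0∞ := fun z =>
    ENNReal.ofReal (Real.exp (labelSup H (ghostWeight sampleSign α η) z)) with hF
  have hFm : AEMeasurable F (Measure.pi fun j : (Bool × Fin m) × Option κ => Q j.1) :=
    (Real.measurable_exp.comp_aemeasurable (hreg.aemeasurable_labelSup
      (fun j : (Bool × Fin m) × Option κ => Q j.1) (fun j => hP _) _)).ennreal_ofReal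
  have hmp := measurePreserving_mergeGhost (κ := κ) Q
  have hFm' : AEMeasurable (fun p => F (mergeGhost p))
      ((Measure.pi Q).prod (Measure.pi fun j : (Bool × Fin m) × κ => Q j.1)) :=
    hFm.comp_quasiMeasurePreserving hmp.quasiMeasurePreserving
  set R : (Bool × Fin m → X) → ℝ≥0∞ := fun x =>
    ∫⁻ g, F (mergeGhost (x, g)) ∂Measure.pi fun j : (Bool × Fin m) × κ => Q j.1 with hR
  have hRm : AEMeasurable R (Measure.pi Q) := hFm'.lintegral_prod_right'
  have hint : ∫⁻ x, R x ∂Measure.pi Q ≤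
      ENNReal.ofReal ((∑ i ∈ Finset.Iic d, (2 * m * (Fintype.card κ + 1)).choose i : ℕ) *
          (2 * (Φ ^ 2 * Real.exp (-(α - η * Fintype.card κ))) ^ m)) := by
    refine le_trans (le_of_eq ?_) (lintegral_exp_labelSup_le hΦ hne hVC hreg Q fun i => hP _)
    rw [hR, ← lintegral_prod _ hFm', ← hmp.map_eq]
    rw [lintegral_map' (by rw [hmp.map_eq]; exact hFm) hmp.measurable.aemeasurable]
  -- Jensen over the ghosts with the sample fixed: their part has mean −η|κ|m(P(A) − Q(A)), whose
  -- absolute value is at most η|κ|mΔ.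
  have hghost : ∀ h ∈ H, ∀ x : Bool × Fin m → X,
      ENNReal.ofReal (Real.exp (|labelSum (fun i => sampleSign i * α) fun i => h (x i)| -
        η * Fintype.card κ * m * Δ)) ≤ R x := by
    intro h hh x
    have hJ := exp_abs_integral_le_lintegral (Measure.pi fun j : (Bool × Fin m) × κ => Q j.1)
      (f := fun g => labelSum (fun i => sampleSign i * α) (fun i => h (x i)) +
        labelSum (fun j : (Bool × Fin m) × κ => -(sampleSign j.1 * η)) (fun j => h (g j)))
      ((measurable_labelSum _ (hH h hh)).const_add _)
      (fun g => (abs_add_le _ _).trans (add_le_add (abs_labelSum_le _ _) (abs_labelSum_le _ _)))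
    have hi : Integrable (fun g => labelSum (fun j : (Bool × Fin m) × κ => -(sampleSign j.1 * η))
        (fun j => h (g j))) (Measure.pi fun j : (Bool × Fin m) × κ => Q j.1) :=
      Integrable.of_bound (measurable_labelSum _ (hH h hh)).aestronglyMeasurable _
        (Filter.Eventually.of_forall fun g => abs_labelSum_le _ _)
    rw [integral_add (integrable_const _) hi, integral_const, integral_labelSum _ _ (hH h hh)]
      at hJ
    have hsum : ∑ j : (Bool × Fin m) × κ, -(sampleSign j.1 * η) * (Q j.1).real (h ⁻¹' {true}) =
        -(η * Fintype.card κ * m *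
          ((P true).real (h ⁻¹' {true}) - (P false).real (h ⁻¹' {true}))) := by
      rw [Fintype.sum_prod_type, Fintype.sum_prod_type, Fintype.sum_bool]
      simp [sampleSign, hQ]
      ring
    rw [hsum] at hJ
    simp only [probReal_univ, one_smul] at hJ
    refine le_trans (ENNReal.ofReal_le_ofReal (Real.exp_le_exp.2 ?_)) (hJ.trans ?_)
    · have h1 := abs_sub_abs_le_abs_sub (labelSum (fun i => sampleSign i * α) fun i => h (x i))
        (η * Fintype.card κ * m * ((P true).real (h ⁻¹' {true}) - (P false).real (h ⁻¹' {true})))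
      rw [← sub_eq_add_neg]
      refine le_trans ?_ h1
      rw [abs_mul, abs_of_nonneg (by positivity : 0 ≤ η * Fintype.card κ * m)]
      have := mul_le_mul_of_nonneg_left (hΔ h hh)
        (by positivity : 0 ≤ η * Fintype.card κ * m)
      linarith
    · refine lintegral_mono fun g => ENNReal.ofReal_le_ofReal (Real.exp_le_exp.2 ?_)
      rw [← labelSum_mergeGhost]
      exact labelSum_le_labelSup _ _ hh
  -- Since R x does not depend on h, the bounds for single hypotheses pass to the supremum. The
  -- condition η|κ| ≤ α then absorbs Δ: αm(Δ + t) − η|κ|mΔ ≥ αmt.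
  have hsub : {x | α * m * (Δ + t) ≤ labelSup H (fun i => sampleSign i * α) x} ⊆
      {x | ENNReal.ofReal (Real.exp (α * m * t)) ≤ R x} := by
    intro x hx
    simp only [Set.mem_ofPred_eq] at hx ⊢
    by_cases htop : R x = ⊤
    · rw [htop]; exact le_top
    have hr : ∀ h : H, |labelSum (fun i => sampleSign i * α) fun i => (h : X → Bool) (x i)| ≤
        Real.log (R x).toReal + η * Fintype.card κ * m * Δ := by
      intro h
      have := (ENNReal.ofReal_le_iff_le_toReal htop).1 (hghost h h.2 x)
      have := (Real.le_log_iff_exp_le ((Real.exp_pos _).trans_le this)).2 this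
      linarith
    have hpos : 0 < (R x).toReal :=
      (Real.exp_pos _).trans_le ((ENNReal.ofReal_le_iff_le_toReal htop).1
        (hghost _ (Classical.arbitrary H).2 x))
    have hs := ciSup_le hr
    refine (ENNReal.ofReal_le_iff_le_toReal htop).2 ((Real.le_log_iff_exp_le hpos).1 ?_)
    have : 0 ≤ (α - η * Fintype.card κ) * m * Δ :=
      mul_nonneg (mul_nonneg (sub_nonneg.2 hαη) (Nat.cast_nonneg _)) hΔ0
    have hs' := hx.trans hs
    linarith
  refine (measure_mono hsub).trans ?_
  refine (meas_ge_le_lintegral_div hRm ?_ ENNReal.ofReal_ne_top).trans ?_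
  · simpa using Real.exp_pos _
  · rw [Real.exp_neg (α * m * t), ENNReal.ofReal_mul (by positivity),
      ENNReal.ofReal_inv_of_pos (Real.exp_pos _), ← div_eq_mul_inv]
    gcongr

/-! ### Choice of the tilts and the resulting tail. -/

/-- The tilts which optimize the ghost sample bound for blocks of `12` points. -/
theorem exists_ghost_tilt {t : ℝ} (h0 : 0 < t) (h1 : t < 1) :
    ∃ α η Φ : ℝ, 0 ≤ η ∧ η * 11 ≤ α ∧
      (∀ y ∈ Set.Icc (0 : ℝ) 1,
        Real.exp (-(η * (11 + 1) * y)) * (1 + y * (Real.exp (α + η) - 1)) ≤ Φ) ∧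
      ∀ m : ℕ, (Φ ^ 2 * Real.exp (-(α - η * 11))) ^ m * Real.exp (-(α * m * t)) =
        Real.exp (-(m * ghostRate t)) := by
  -- If the real frequencies differ by t and the ghost frequencies agree, the block frequencies
  -- differ by t/12. The extremal configuration has real frequencies (1 ± t)/2 and block frequencies
  -- (1 ± s)/2; 1 + B is the odds ratio of (1 + t)/2 to (1 + s)/2.
  set s := t / 12 with hs
  have hs0 : 0 < s := by positivity
  have hst : s < t := by rw [hs]; linarith
  have hs1 : 0 < 1 - s := by linarith
  have ht1 : 0 < 1 - t := by linarith
  set B := 2 * (t - s) / ((1 - t) * (1 + s)) with hB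
  have hB0 : 0 ≤ B := by have : 0 ≤ t - s := by linarith
                         positivity
  set w := (1 - s) / (1 - t) with hw
  have hw0 : 0 < w := by positivity
  set γ := 2 * (t - s) / ((1 - s) * (1 + s)) with hγ
  have hγ0 : 0 ≤ γ := by have : 0 ≤ t - s := by linarith
                         positivity
  have hBw : B = γ * w := by rw [hB, hγ, hw]; field_simp
  have h1B : 1 + B = (1 + t) / (1 + s) * w := by rw [hB, hw]; field_simp; ring
  -- This is the requirement 11η ≤ α; it follows from log(1 + B) ≥ 2B/(B + 2).
  have hγlog : γ ≤ Real.log (1 + B) := by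
    refine le_trans ?_ (Real.le_log_one_add_of_nonneg hB0)
    rw [le_div_iff₀ (by linarith), hBw]
    have h2w : γ * w + 2 ≤ 2 * w := by
      rw [← hBw, hB, hw, ← sub_nonneg]
      have : 2 * ((1 - s) / (1 - t)) - (2 * (t - s) / ((1 - t) * (1 + s)) + 2) =
          2 * (s * (t - s)) / ((1 - t) * (1 + s)) := by field_simp; ring
      rw [this]
      have : 0 ≤ t - s := by linarith
      positivity
    nlinarith
  -- Thus e^(α+η) = 1 + B and 12η = γ = B/w. The value Φ is the maximum of e^(−γy)(1 + By), attained
  -- at y = (1 + s)/2, where 1 + x ≤ e^x is used with x = 0.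
  refine ⟨Real.log (1 + B) - γ / 12, γ / 12, w * Real.exp (w⁻¹ - 1), by positivity, by linarith,
    fun y _ => ?_, fun m => ?_⟩
  · rw [sub_add_cancel, Real.exp_log (by linarith), Real.exp_neg, inv_mul_le_iff₀ (Real.exp_pos _)]
    have h := Real.add_one_le_exp (w⁻¹ + γ * y - 1)
    have hexp : Real.exp (γ / 12 * (11 + 1) * y) * (w * Real.exp (w⁻¹ - 1)) =
        w * Real.exp (w⁻¹ + γ * y - 1) := by
      rw [mul_left_comm, ← Real.exp_add]
      ring_nf
    rw [hexp]
    calc 1 + y * (1 + B - 1) = w * (w⁻¹ + γ * y - 1 + 1) := by rw [hBw]; field_simp; ring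
      _ ≤ _ := mul_le_mul_of_nonneg_left h hw0.le
  · have hΦ : (w * Real.exp (w⁻¹ - 1)) ^ 2 = Real.exp (2 * (Real.log w + w⁻¹ - 1)) := by
      rw [show w * Real.exp (w⁻¹ - 1) = Real.exp (Real.log w + w⁻¹ - 1) by
        rw [add_sub_assoc, Real.exp_add, Real.exp_log hw0], ← Real.exp_nat_mul]
      norm_num
    rw [hΦ, ← Real.exp_add, ← Real.exp_nat_mul, ← Real.exp_add]
    congr 1
    have hwi : w⁻¹ = 1 - γ * (1 + s) / 2 := by rw [hw, hγ]; field_simp; ring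
    have hl1 : Real.log (1 + B) = Real.log ((1 + t) / (1 + s)) + Real.log w := by
      rw [h1B, Real.log_mul (by positivity) hw0.ne']
    have hl2 : Real.log ((1 - t) / (1 - s)) = -Real.log w := by
      rw [← Real.log_inv, hw, inv_div]
    have hE : ghostRate t = (1 + t) * Real.log ((1 + t) / (1 + s)) - (1 - t) * Real.log w := by
      rw [ghostRate, ← hs, hl2]; ring
    have ht12 : t = 12 * s := by rw [hs]; ring
    rw [hE, hl1, hwi, ht12]
    ring

/-- For d > 0, Sauer's bound on 24m points is (em/d)^d · 24^d, and the rate pays for both factors.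
For d = 0 there is a single labelling and 121/144 ≥ 1/2 suffices. -/
theorem card_mul_exp_ghostRate_le {m d : ℕ} (hdm : d ≤ m) {t c : ℝ} (h0 : 0 < t) (h1 : t < 1)
    (hc : 0 ≤ c) (ht : m * t ^ 2 / 2 = c + d * Real.log (Real.exp 1 * m / d)) :
    (∑ i ∈ Finset.Iic d, (2 * m * (11 + 1)).choose i : ℕ) *
      (2 * Real.exp (-(m * ghostRate t))) ≤ 2 * Real.exp (-c) := by
  rcases Nat.eq_zero_or_pos d with rfl | hd
  · have hg := ghostRate_ge h0 h1
    have hf : 121 / 144 ≤ rateFactor (t ^ 2) :=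
      le_trans (by norm_num [rateFactor]) (rateFactor_mono le_rfl (sq_nonneg t))
    have hg2 : t ^ 2 / 2 ≤ ghostRate t := by nlinarith [sq_nonneg t]
    have hm : m * (t ^ 2 / 2) ≤ m * ghostRate t := mul_le_mul_of_nonneg_left hg2 (Nat.cast_nonneg _)
    have : Finset.Iic 0 = ({0} : Finset ℕ) := rfl
    simp only [this, Finset.sum_singleton, Nat.choose_zero_right, Nat.cast_one, one_mul]
    simp only [Nat.cast_zero, zero_mul, add_zero] at ht
    gcongr
    linarith
  · have hd0 : (0 : ℝ) < d := by exact_mod_cast hd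
    have hm0 : (0 : ℝ) < m := by exact_mod_cast hd.trans_le hdm
    have hlog : Real.log (Real.exp 1 * m / d) = 1 + Real.log (m / d) := by
      rw [mul_div_assoc, Real.log_mul (Real.exp_pos _).ne' (by positivity), Real.log_exp]
    have hE := mul_ghostRate_ge hd hdm h0 h1 (by rw [ht, hlog]; linarith)
    have hN := sum_choose_le_exp_mul_div_pow hd (show d ≤ 2 * m * (11 + 1) by omega)
    have hexp : Real.exp (-(m * ghostRate t)) ≤
        Real.exp (-c) * ((Real.exp 1 * m / d) ^ d * 24 ^ d)⁻¹ := by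
      have hpow : (Real.exp 1 * m / d) ^ d * 24 ^ d =
          Real.exp (d * Real.log (Real.exp 1 * m / d) + d * Real.log 24) := by
        rw [Real.exp_add, Real.exp_nat_mul, Real.exp_nat_mul, Real.exp_log (by positivity),
          Real.exp_log (by norm_num)]
      rw [hpow, ← Real.exp_neg, ← Real.exp_add]
      exact Real.exp_le_exp.2 (by linarith)
    calc _ ≤ (Real.exp 1 * (2 * m * (11 + 1) : ℕ) / d) ^ d *
          (2 * (Real.exp (-c) * ((Real.exp 1 * m / d) ^ d * 24 ^ d)⁻¹)) := by gcongr
      _ = 2 * Real.exp (-c) := by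
          have : Real.exp 1 * (2 * m * (11 + 1) : ℕ) / d = (Real.exp 1 * m / d) * 24 := by
            push_cast; ring
          rw [this, mul_pow]
          have h24 : (Real.exp 1 * m / d) ^ d * (24 : ℝ) ^ d ≠ 0 := by positivity
          field_simp

/-! ### Lower tail, and the deviation for one source. -/

theorem labelSup_smul {X J : Type*} [Fintype J] (H : Set (X → Bool)) (w : J → ℝ) {c : ℝ}
    (hc : 0 ≤ c) (z : J → X) : labelSup H (fun j => w j * c) z = c * labelSup H w z := by
  unfold labelSup labelSum
  rw [Real.mul_iSup_of_nonneg hc]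
  congr 1
  funext h
  rw [← abs_of_nonneg hc, ← abs_mul, abs_of_nonneg hc, Finset.mul_sum]
  congr 1
  exact Finset.sum_congr rfl fun j _ => by ring

/-- Hoeffding's inequality for the difference of the frequencies in two samples. -/
theorem measure_labelSum_le {X : Type*} [MeasurableSpace X] {m : ℕ}
    (P : Bool → Measure X) [∀ i, IsProbabilityMeasure (P i)] {h : X → Bool} (hh : Measurable h)
    {e : ℝ} (he : e = 1 ∨ e = -1) {s : ℝ} (hs : 0 ≤ s) :
    (Measure.pi fun i : Bool × Fin m => P i.1).real
      {x | e * labelSum sampleSign (fun i => h (x i)) ≤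
        e * (m * ((P true).real (h ⁻¹' {true}) - (P false).real (h ⁻¹' {true}))) - m * s} ≤
      Real.exp (-(m * s ^ 2)) := by
  set μ := Measure.pi fun i : Bool × Fin m => P i.1 with hμ
  have hmb : Measurable fun b : Bool => if b = true then (1 : ℝ) else 0 := measurable_of_finite _
  set Y : Bool × Fin m → X → ℝ := fun i x => -(e * sampleSign i) * if h x = true then 1 else 0
    with hY
  have hYm : ∀ i, Measurable (Y i) := fun i => (hmb.comp hh).const_mul _
  have hsign : ∀ i : Bool × Fin m, -(e * sampleSign i) = 1 ∨ -(e * sampleSign i) = -1 := by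
    intro i
    unfold sampleSign
    rcases he with rfl | rfl <;> split_ifs <;> norm_num
  have hind : iIndepFun (fun i (x : Bool × Fin m → X) => Y i (x i)) μ :=
    iIndepFun_pi fun i => (hYm i).aemeasurable
  have hind' : iIndepFun (fun i (x : Bool × Fin m → X) => Y i (x i) -
      ∫ x, Y i (x i) ∂μ) μ :=
    hind.comp (fun i y => y - ∫ x, Y i (x i) ∂μ) fun i => measurable_id.sub_const _
  have hsub : ∀ i ∈ Finset.univ, HasSubgaussianMGF (fun x : Bool × Fin m → X => Y i (x i) -
      ∫ x, Y i (x i) ∂μ) (1 / 4) μ := by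
    intro i _
    have hm' : AEMeasurable (fun x : Bool × Fin m → X => Y i (x i)) μ :=
      ((hYm i).comp (measurable_pi_apply i)).aemeasurable
    rcases hsign i with hi | hi
    · have := hasSubgaussianMGF_of_mem_Icc (a := 0) (b := 1) hm'
        (Filter.Eventually.of_forall fun x => by
          simp only [hY, hi]; split_ifs <;> norm_num)
      convert this using 1
      norm_num
    · have := hasSubgaussianMGF_of_mem_Icc (a := -1) (b := 0) hm'
        (Filter.Eventually.of_forall fun x => by
          simp only [hY, hi]; split_ifs <;> norm_num)
      convert this using 1
      norm_num
  -- Each of the 2m terms has variance proxy 1/4, so the exponent is (ms)²/(2 · 2m/4) = ms².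
  have hoef := HasSubgaussianMGF.measure_sum_ge_le_of_iIndepFun hind' hsub
    (mul_nonneg (Nat.cast_nonneg m) hs)
  have hsumY : ∀ x : Bool × Fin m → X, ∑ i, Y i (x i) =
      -(e * labelSum sampleSign fun i => h (x i)) := by
    intro x
    unfold labelSum
    rw [Finset.mul_sum, ← Finset.sum_neg_distrib]
    exact Finset.sum_congr rfl fun i _ => by simp only [hY]; ring
  have hmean : ∑ i, ∫ x, Y i (x i) ∂μ =
      -(e * (m * ((P true).real (h ⁻¹' {true}) - (P false).real (h ⁻¹' {true})))) := by
    rw [← integral_finsetSum]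
    · simp only [hsumY]
      rw [integral_neg, integral_const_mul, hμ, integral_labelSum _ _ hh, Fintype.sum_prod_type,
        Fintype.sum_bool]
      simp only [sampleSign, if_true, Bool.false_eq_true, if_false, Finset.sum_const,
        Finset.card_univ, Fintype.card_fin, nsmul_eq_mul]
      ring
    · intro i _
      refine Integrable.of_bound ((hYm i).comp (measurable_pi_apply i)).aestronglyMeasurable 1
        (Filter.Eventually.of_forall fun x => ?_)
      rcases hsign i with hi | hi <;> simp only [hY, hi] <;> split_ifs <;> norm_num
  have hset : {x : Bool × Fin m → X | (m : ℝ) * s ≤ ∑ i, (Y i (x i) - ∫ x, Y i (x i) ∂μ)} =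
      {x | e * labelSum sampleSign (fun i => h (x i)) ≤
        e * (m * ((P true).real (h ⁻¹' {true}) - (P false).real (h ⁻¹' {true}))) - m * s} := by
    ext x
    simp only [Set.mem_ofPred_eq, Finset.sum_sub_distrib, hmean, hsumY]
    constructor <;> intro h <;> linarith
  rw [hset] at hoef
  refine hoef.trans (le_of_eq ?_)
  congr 1
  rcases Nat.eq_zero_or_pos m with rfl | hm
  · simp
  · have : (0 : ℝ) < m := by exact_mod_cast hm
    simp
    field_simp
    norm_num

/-- The deviation inequality for the divergence between one source and the target. -/
theorem measure_abs_sub_labelSup_le {X : Type*} [MeasurableSpace X]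
    {m d : ℕ} (hm : 0 < m) (hdm : d ≤ m) {t c : ℝ} (h0 : 0 < t) (h1 : t < 1) (hc : 0 ≤ c)
    (ht : m * t ^ 2 / 2 = c + d * Real.log (Real.exp 1 * m / d))
    {H : Set (X → Bool)} (hne : H.Nonempty) (hH : ∀ h ∈ H, Measurable h)
    (hVC : HasVCDim H d) {D : Set (Measure X)} (hreg : IsMeasurableClass H D)
    (P : Bool → Measure X) [∀ i, IsProbabilityMeasure (P i)] (hP : ∀ i, P i ∈ D) :
    Measure.pi (fun i : Bool × Fin m => P i.1)
        {x | t < |(⨆ h : H, |(P true).real ((h : X → Bool) ⁻¹' {true}) -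
          (P false).real ((h : X → Bool) ⁻¹' {true})|) -
            labelSup H (fun i => sampleSign i * (1 / (m : ℝ))) x|} ≤
      ENNReal.ofReal (3 * Real.exp (-c)) := by
  have := hne.to_subtype
  have hm0 : (0 : ℝ) < m := by exact_mod_cast hm
  set μ := Measure.pi (fun i : Bool × Fin m => P i.1) with hμ
  set f : H → ℝ := fun h => |(P true).real ((h : X → Bool) ⁻¹' {true}) -
          (P false).real ((h : X → Bool) ⁻¹' {true})| with hf
  have hf1 : ∀ h, f h ≤ 1 := by
    intro h
    have a1 : (P true).real ((h : X → Bool) ⁻¹' {true}) ≤ 1 := measureReal_le_one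
    have a2 : (P false).real ((h : X → Bool) ⁻¹' {true}) ≤ 1 := measureReal_le_one
    have a3 : 0 ≤ (P true).real ((h : X → Bool) ⁻¹' {true}) := measureReal_nonneg
    have a4 : 0 ≤ (P false).real ((h : X → Bool) ⁻¹' {true}) := measureReal_nonneg
    exact abs_le.2 ⟨by linarith, by linarith⟩
  have hbdd : BddAbove (Set.range f) := ⟨1, by rintro _ ⟨h, rfl⟩; exact hf1 h⟩
  set Δ : ℝ := ⨆ h, f h with hΔ
  have hΔ0 : 0 ≤ Δ := Real.iSup_nonneg fun h => abs_nonneg _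
  have hfΔ : ∀ h : H, f h ≤ Δ := fun h => le_ciSup hbdd h
  have hZ : ∀ x : Bool × Fin m → X, labelSup H (fun i => sampleSign i * (1 / (m : ℝ))) x =
      1 / (m : ℝ) * labelSup H sampleSign x := fun x => labelSup_smul H _ (by positivity) x
  obtain ⟨α, η, Φ, hη, hαη, hΦ, hrate⟩ := exists_ghost_tilt h0 h1
  have hα : 0 ≤ α := le_trans (by positivity) hαη
  have hup : μ {x | Δ + t ≤ labelSup H (fun i => sampleSign i * (1 / (m : ℝ))) x} ≤
      ENNReal.ofReal (2 * Real.exp (-c)) := by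
    have hmain := measure_labelSup_ge_le (κ := Fin 11) (m := m) (t := t) hη
      (by simpa using hαη) (by simpa using hΦ) hne hH hVC hreg P hP hΔ0
      fun h hh => hfΔ ⟨h, hh⟩
    refine (measure_mono fun x hx => ?_).trans (hmain.trans (ENNReal.ofReal_le_ofReal ?_))
    · simp only [Set.mem_ofPred_eq] at hx ⊢
      rw [labelSup_smul H _ hα]
      rw [hZ] at hx
      have := mul_le_mul_of_nonneg_left hx (mul_nonneg hα hm0.le)
      refine this.trans (le_of_eq ?_)
      field_simp
    · refine le_trans (le_of_eq ?_) (card_mul_exp_ghostRate_le hdm h0 h1 hc ht)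
      rw [← hrate m]
      simp only [Fintype.card_fin]
      push_cast
      ring
  have hlow : μ {x | labelSup H (fun i => sampleSign i * (1 / (m : ℝ))) x ≤ Δ - t} ≤
      ENNReal.ofReal (Real.exp (-c)) := by
    -- The supremum need not be attained. Losing t/4 leaves a deviation 3t/4, and (3/4)² = 9/16
    -- still exceeds the 1/2 that is needed.
    obtain ⟨h, hh⟩ := exists_lt_of_lt_ciSup (show Δ - t / 4 < ⨆ h, f h by linarith)
    set D := (P true).real ((h : X → Bool) ⁻¹' {true}) -
          (P false).real ((h : X → Bool) ⁻¹' {true}) with hD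
    obtain ⟨e, he, heD⟩ : ∃ e : ℝ, (e = 1 ∨ e = -1) ∧ f h = e * D := by
      rcases abs_cases D with ⟨h, _⟩ | ⟨h, _⟩
      · exact ⟨1, Or.inl rfl, by rw [one_mul]; exact h⟩
      · exact ⟨-1, Or.inr rfl, by rw [neg_one_mul]; exact h⟩
    have hoef := measure_labelSum_le (m := m) P (hH h h.2) he (s := 3 * t / 4) (by positivity)
    have hle : Real.exp (-(m * (3 * t / 4) ^ 2)) ≤ Real.exp (-c) := by
      refine Real.exp_le_exp.2 (neg_le_neg ?_)
      have hlog : 0 ≤ d * Real.log (Real.exp 1 * m / d) := by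
        rcases Nat.eq_zero_or_pos d with rfl | hd
        · simp
        · have hd0 : (0 : ℝ) < d := by exact_mod_cast hd
          have hdm' : (d : ℝ) ≤ m := by exact_mod_cast hdm
          refine mul_nonneg hd0.le (Real.log_nonneg ((one_le_div hd0).2 ?_))
          have := Real.add_one_le_exp 1
          nlinarith
      nlinarith [mul_nonneg hm0.le (sq_nonneg t)]
    refine (measure_mono fun x hx => ?_).trans (b := μ {x | e * labelSum sampleSign
        (fun i => (h : X → Bool) (x i)) ≤ e * (m * D) - m * (3 * t / 4)}) ?_
    · simp only [Set.mem_ofPred_eq] at hx ⊢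
      rw [hZ] at hx
      have h2 := labelSum_le_labelSup (sampleSign (m := m)) x h.2
      have h3 : e * labelSum sampleSign (fun i => (h : X → Bool) (x i)) ≤ labelSup H sampleSign x := by
        refine le_trans ?_ h2
        rcases he with rfl | rfl
        · rw [one_mul]; exact le_abs_self _
        · rw [neg_one_mul]; exact neg_le_abs _
      have h4 : labelSup H sampleSign x ≤ m * (Δ - t) := by
        have := mul_le_mul_of_nonneg_left hx hm0.le
        rwa [← mul_assoc, mul_one_div_cancel hm0.ne', one_mul] at this
      have h5 := mul_le_mul_of_nonneg_left hh.le hm0.le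
      rw [heD] at h5
      linarith
    · rw [← ofReal_measureReal (measure_ne_top _ _)]
      exact ENNReal.ofReal_le_ofReal (hoef.trans hle)
  refine (measure_mono (t := {x | Δ + t ≤ labelSup H (fun i => sampleSign i * (1 / (m : ℝ))) x} ∪
      {x | labelSup H (fun i => sampleSign i * (1 / (m : ℝ))) x ≤ Δ - t}) fun x hx => ?_).trans
    ((measure_union_le _ _).trans ((add_le_add hup hlow).trans (le_of_eq ?_)))
  · simp only [Set.mem_ofPred_eq, Set.mem_union] at hx ⊢
    rcases lt_abs.1 hx with h | h
    · exact Or.inr (by linarith)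
    · exact Or.inl (by linarith)
  · rw [← ENNReal.ofReal_add (by positivity) (by positivity)]
    ring_nf

/-! ### Divergences of empirical measures as label suprema. -/

theorem hDivergence_eq_iSup {X : Type*} [MeasurableSpace X] (H : Set (X → Bool))
    (P Q : Measure X) :
    hDivergence H P Q = 2 * ⨆ h : H, |P.real ((h : X → Bool) ⁻¹' {true}) -
      Q.real ((h : X → Bool) ⁻¹' {true})| := by
  unfold hDivergence
  congr 1
  let g : H → hypothesisSets H := fun h => ⟨(h : X → Bool) ⁻¹' {true}, h, h.2, rfl⟩
  have hg : Function.Surjective g := by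
    rintro ⟨_, h, hh, rfl⟩
    exact ⟨⟨h, hh⟩, rfl⟩
  exact (hg.iSup_comp fun A : hypothesisSets H => |P.real (A : Set X) - Q.real (A : Set X)|).symm

theorem empiricalMeasure_real {X : Type*} [MeasurableSpace X] {m : ℕ} (x : Fin m → X)
    {h : X → Bool} (hh : Measurable h) :
    (empiricalMeasure x).real (h ⁻¹' {true}) =
      1 / (m : ℝ) * ∑ j, if h (x j) = true then 1 else 0 := by
  have hset : MeasurableSet (h ⁻¹' {true}) := hh (measurableSet_singleton _)
  unfold empiricalMeasure
  rw [Measure.real, Measure.smul_apply, Measure.finsetSum_apply, smul_eq_mul, ENNReal.toReal_mul,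
    ENNReal.toReal_inv, ENNReal.toReal_natCast, one_div, ENNReal.toReal_sum]
  · congr 1
    refine Finset.sum_congr rfl fun j _ => ?_
    rw [Measure.dirac_apply' _ hset]
    by_cases hx : h (x j) = true
    · rw [if_pos hx, Set.indicator_of_mem (show x j ∈ h ⁻¹' {true} from hx)]; simp
    · rw [if_neg hx, Set.indicator_of_notMem (show x j ∉ h ⁻¹' {true} from hx)]; simp
  · intro j _
    exact measure_ne_top _ _

/-- Two samples as one family. -/
def pairSample {X : Type*} {m : ℕ} (x y : Fin m → X) (i : Bool × Fin m) : X :=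
  if i.1 = true then x i.2 else y i.2

theorem hDivergence_empiricalMeasure {X : Type*} [MeasurableSpace X] {m : ℕ}
    {H : Set (X → Bool)} (hH : ∀ h ∈ H, Measurable h) (x y : Fin m → X) :
    hDivergence H (empiricalMeasure x) (empiricalMeasure y) =
      2 * labelSup H (fun i => sampleSign i * (1 / (m : ℝ))) (pairSample x y) := by
  rw [hDivergence_eq_iSup]
  unfold labelSup
  congr 2
  funext h
  rw [empiricalMeasure_real x (hH h h.2), empiricalMeasure_real y (hH h h.2)]
  congr 1
  unfold labelSum
  rw [Fintype.sum_prod_type, Fintype.sum_bool]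
  simp only [sampleSign, pairSample, if_true, Bool.false_eq_true, if_false, Finset.mul_sum]
  rw [← Finset.sum_sub_distrib, ← Finset.sum_add_distrib]
  exact Finset.sum_congr rfl fun j _ => by ring

theorem hDivergence_mem_Icc {X : Type*} [MeasurableSpace X] (H : Set (X → Bool))
    (P Q : Measure X) [IsProbabilityMeasure P] [IsProbabilityMeasure Q] :
    hDivergence H P Q ∈ Set.Icc (0 : ℝ) 2 := by
  rw [hDivergence_eq_iSup]
  have h0 : 0 ≤ ⨆ h : H, |P.real ((h : X → Bool) ⁻¹' {true}) - Q.real ((h : X → Bool) ⁻¹' {true})| :=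
    Real.iSup_nonneg fun h => abs_nonneg _
  have h1 : ⨆ h : H, |P.real ((h : X → Bool) ⁻¹' {true}) - Q.real ((h : X → Bool) ⁻¹' {true})| ≤ 1 := by
    refine Real.iSup_le (fun h => ?_) zero_le_one
    have a1 : P.real ((h : X → Bool) ⁻¹' {true}) ≤ 1 := measureReal_le_one
    have a2 : Q.real ((h : X → Bool) ⁻¹' {true}) ≤ 1 := measureReal_le_one
    have a3 : 0 ≤ P.real ((h : X → Bool) ⁻¹' {true}) := measureReal_nonneg
    have a4 : 0 ≤ Q.real ((h : X → Bool) ⁻¹' {true}) := measureReal_nonneg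
    exact abs_le.2 ⟨by linarith, by linarith⟩
  constructor <;> linarith

theorem isProbabilityMeasure_empiricalMeasure {X : Type*} [MeasurableSpace X] {m : ℕ} (hm : 0 < m)
    (x : Fin m → X) : IsProbabilityMeasure (empiricalMeasure x) := by
  constructor
  unfold empiricalMeasure
  rw [Measure.smul_apply, Measure.finsetSum_apply]
  simp only [measure_univ, Finset.sum_const, Finset.card_univ, Fintype.card_fin, nsmul_eq_mul,
    mul_one, smul_eq_mul]
  exact ENNReal.inv_mul_cancel (by exact_mod_cast hm.ne') (ENNReal.natCast_ne_top _)

theorem abs_iSup_sub_iSup_le {ι : Type*} [Finite ι] [Nonempty ι] {f g : ι → ℝ} {c : ℝ}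
    (h : ∀ i, |f i - g i| ≤ c) : |(⨆ i, f i) - ⨆ i, g i| ≤ c := by
  have hf := (Set.finite_range f).bddAbove
  have hg := (Set.finite_range g).bddAbove
  refine abs_le.2 ⟨?_, ?_⟩
  · have : ⨆ i, g i ≤ (⨆ i, f i) + c := ciSup_le fun i => by
      have := (abs_le.1 (h i)).1
      have := le_ciSup hf i
      linarith
    linarith
  · have : ⨆ i, f i ≤ (⨆ i, g i) + c := ciSup_le fun i => by
      have := (abs_le.1 (h i)).2
      have := le_ciSup hg i
      linarith
    linarith

/-! ### Union over the sources. -/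

theorem mainTheorem5 {X Ω : Type*} [MeasurableSpace X] [MeasurableSpace Ω]
    (μ : Measure Ω) [IsProbabilityMeasure μ]
    (k m d : ℕ) (hk : 0 < k) (hm : 0 < m) (hdm : d ≤ m)
    (DT : Measure X) [IsProbabilityMeasure DT]
    (DS : Fin k → Measure X) [∀ i, IsProbabilityMeasure (DS i)]
    (H : Set (X → Bool)) (hH : ∀ h ∈ H, Measurable h)
    (hreg : IsMeasurableClass H (insert DT (Set.range DS)))
    (hVC : HasVCDim H d)
    (xT : Fin m → Ω → X) (xS : Fin k → Fin m → Ω → X)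
    (hxT : ∀ j, HasLaw (xT j) DT μ)
    (hxS : ∀ i j, HasLaw (xS i j) (DS i) μ)
    (hindep : iIndepFun (Sum.elim xT fun p : Fin k × Fin m => xS p.1 p.2) μ)
    (δ : ℝ) (hδ0 : 0 < δ) (hδ1 : δ < 1) :
    NullMeasurableSet
        {ω | |multiHDivergence H DT DS -
              multiHDivergence H (empiricalMeasure fun j => xT j ω)
                (fun i => empiricalMeasure fun j => xS i j ω)| ≤
            2 * Real.sqrt ((2 / (m : ℝ)) *
              (Real.log (4 * k / δ) + d * Real.log (Real.exp 1 * m / d)))} μ ∧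
      1 - δ ≤ μ.real
        {ω | |multiHDivergence H DT DS -
              multiHDivergence H (empiricalMeasure fun j => xT j ω)
                (fun i => empiricalMeasure fun j => xS i j ω)| ≤
            2 * Real.sqrt ((2 / (m : ℝ)) *
              (Real.log (4 * k / δ) + d * Real.log (Real.exp 1 * m / d)))} := by
  have hm0 : (0 : ℝ) < m := by exact_mod_cast hm
  have hk0 : (0 : ℝ) < k := by exact_mod_cast hk
  have hk1 : (1 : ℝ) ≤ k := by exact_mod_cast hk
  have : Nonempty (Fin k) := ⟨⟨0, hk⟩⟩
  -- An empty class has growth function 0, never a power of 2, so it has no VC dimension.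
  have hne : H.Nonempty := by
    by_contra hempty
    rw [Set.not_nonempty_iff_eq_empty] at hempty
    have h1 : growthFunction H d = 2 ^ d := hVC.1
    have h2 : growthFunction H d = 0 := by
      subst hempty
      exact le_antisymm (ciSup_le' fun S => by simp) (Nat.zero_le _)
    rw [h2] at h1
    exact absurd h1.symm (by positivity)
  set c := Real.log (4 * k / δ) with hc
  set t := Real.sqrt ((2 / (m : ℝ)) * (c + d * Real.log (Real.exp 1 * m / d))) with ht
  let P : Fin k → Bool → Measure X := fun i b => if b = true then DT else DS i
  have hPprob : ∀ i b, IsProbabilityMeasure (P i b) := by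
    intro i b
    cases b <;> simp only [P] <;> infer_instance
  have hPD : ∀ i b, P i b ∈ insert DT (Set.range DS) := by
    intro i b
    cases b
    · exact Or.inr ⟨i, rfl⟩
    · exact Or.inl rfl
  let S : Fin k → Ω → Bool × Fin m → X := fun i ω => pairSample (fun j => xT j ω) fun j => xS i j ω
  have hSlaw : ∀ i (p : Bool × Fin m), HasLaw (fun ω => S i ω p) (P i p.1) μ := by
    rintro i ⟨b, j⟩
    cases b
    · exact hxS i j
    · exact hxT j
  have hSind : ∀ i, iIndepFun (fun (p : Bool × Fin m) ω => S i ω p) μ := by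
    intro i
    let g : Bool × Fin m → Fin m ⊕ Fin k × Fin m := fun p =>
      if p.1 = true then Sum.inl p.2 else Sum.inr (i, p.2)
    have hg : Function.Injective g := by
      rintro ⟨_ | _, j⟩ ⟨_ | _, j'⟩ h <;> simp_all [g]
    have h := hindep.precomp hg
    convert h using 1
    funext ⟨b, j⟩ ω
    cases b <;> rfl
  have hSm : ∀ i, AEMeasurable (S i) μ := fun i =>
    aemeasurable_pi_lambda _ fun p => (hSlaw i p).aemeasurable
  have hSmap : ∀ i, μ.map (S i) = Measure.pi fun p : Bool × Fin m => P i p.1 := by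
    intro i
    have h := (iIndepFun_iff_map_fun_eq_pi_map fun p => (hSlaw i p).aemeasurable).1 (hSind i)
    simp only [(hSlaw i _).map_eq] at h
    exact h
  set W : (Bool × Fin m → X) → ℝ := labelSup H (fun i => sampleSign i * (1 / (m : ℝ))) with hW
  have hWm : ∀ i, AEMeasurable W (Measure.pi fun p : Bool × Fin m => P i p.1) := fun i =>
    hreg.aemeasurable_labelSup (fun p : Bool × Fin m => P i p.1) (fun p => hPD i p.1) _
  have hWS : ∀ i, AEMeasurable (fun ω => W (S i ω)) μ := fun i =>
    AEMeasurable.comp_aemeasurable (g := W) (by rw [hSmap i]; exact hWm i) (hSm i)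
  have hemp : ∀ ω, multiHDivergence H (empiricalMeasure fun j => xT j ω)
      (fun i => empiricalMeasure fun j => xS i j ω) = ⨆ i, 2 * W (S i ω) := by
    intro ω
    unfold multiHDivergence
    congr 1
    funext i
    exact hDivergence_empiricalMeasure hH _ _
  set A := {ω | |multiHDivergence H DT DS -
              multiHDivergence H (empiricalMeasure fun j => xT j ω)
                (fun i => empiricalMeasure fun j => xS i j ω)| ≤ 2 * t} with hA
  have hAm : NullMeasurableSet A μ := by
    have hmeas : AEMeasurable (fun ω => |multiHDivergence H DT DS -
        multiHDivergence H (empiricalMeasure fun j => xT j ω)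
          (fun i => empiricalMeasure fun j => xS i j ω)|) μ := by
      simp only [hemp]
      exact ((AEMeasurable.iSup fun i => (hWS i).const_mul 2).const_sub _).abs
    exact nullMeasurableSet_le hmeas aemeasurable_const
  refine ⟨hAm, ?_⟩
  -- For t ≥ 1 the bound is trivial because divergences lie in [0, 2]; the tilts require t < 1.
  rcases le_or_gt 1 t with h1 | h1
  · have huniv : A = Set.univ := by
      refine Set.eq_univ_of_forall fun ω => ?_
      refine abs_iSup_sub_iSup_le fun i => ?_
      have := isProbabilityMeasure_empiricalMeasure hm fun j => xT j ω
      have := isProbabilityMeasure_empiricalMeasure hm fun j => xS i j ω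
      have hb1 := hDivergence_mem_Icc H DT (DS i)
      have hb2 := hDivergence_mem_Icc H (empiricalMeasure fun j => xT j ω)
        (empiricalMeasure fun j => xS i j ω)
      exact abs_le.2 ⟨by linarith [hb1.1, hb2.2], by linarith [hb1.2, hb2.1]⟩
    rw [huniv, probReal_univ]
    linarith
  have hc0 : 0 < c := Real.log_pos (by rw [one_lt_div hδ0]; linarith)
  have hL0 : 0 ≤ d * Real.log (Real.exp 1 * m / d) := by
    rcases Nat.eq_zero_or_pos d with rfl | hd
    · simp
    · have hd0 : (0 : ℝ) < d := by exact_mod_cast hd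
      have hdm' : (d : ℝ) ≤ m := by exact_mod_cast hdm
      refine mul_nonneg hd0.le (Real.log_nonneg ((one_le_div hd0).2 ?_))
      have := Real.add_one_le_exp 1
      nlinarith
  have ht0 : 0 < t := Real.sqrt_pos.2 (by positivity)
  have ht2 : m * t ^ 2 / 2 = c + d * Real.log (Real.exp 1 * m / d) := by
    rw [ht, Real.sq_sqrt (by positivity)]
    field_simp
  have hbad : ∀ i, μ {ω | 2 * t < |hDivergence H DT (DS i) - 2 * W (S i ω)|} ≤
      ENNReal.ofReal (3 * Real.exp (-c)) := by
    intro i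
    have hdev := measure_abs_sub_labelSup_le hm hdm ht0 h1 hc0.le ht2 hne hH hVC hreg (P i) (hPD i)
    rw [← hSmap i] at hdev
    have hnull : NullMeasurableSet {x | t < |(⨆ h : H, |(P i true).real ((h : X → Bool) ⁻¹' {true}) -
          (P i false).real ((h : X → Bool) ⁻¹' {true})|) - W x|} (μ.map (S i)) := by
      rw [hSmap i]
      exact nullMeasurableSet_lt aemeasurable_const ((hWm i).const_sub _).abs
    rw [Measure.map_apply₀ (hSm i) hnull] at hdev
    refine (measure_mono fun ω hω => ?_).trans hdev
    simp only [Set.mem_ofPred_eq, Set.mem_preimage] at hω ⊢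
    rw [hDivergence_eq_iSup, ← mul_sub, abs_mul, abs_two] at hω
    exact lt_of_mul_lt_mul_left hω zero_le_two
  have hcompl : Aᶜ ⊆ ⋃ i, {ω | 2 * t < |hDivergence H DT (DS i) - 2 * W (S i ω)|} := by
    intro ω hω
    by_contra hnot
    simp only [Set.mem_iUnion, Set.mem_ofPred_eq, not_exists, not_lt] at hnot
    refine hω ?_
    simp only [hA, Set.mem_ofPred_eq, hemp]
    exact abs_iSup_sub_iSup_le hnot
  -- The two tails of one source cost 3δ/(4k), so the k sources together cost 3δ/4.
  have hexp : 3 * Real.exp (-c) = 3 * δ / (4 * k) := by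
    rw [Real.exp_neg, hc, Real.exp_log (by positivity)]
    field_simp
  have hμ : μ Aᶜ ≤ ENNReal.ofReal δ := by
    refine (measure_mono hcompl).trans ((measure_iUnion_fintype_le _ _).trans
      ((Finset.sum_le_sum fun i _ => hbad i).trans ?_))
    rw [Finset.sum_const, Finset.card_univ, Fintype.card_fin, nsmul_eq_mul,
      ← ENNReal.ofReal_natCast, ← ENNReal.ofReal_mul (by positivity), hexp]
    refine ENNReal.ofReal_le_ofReal ?_
    rw [show (k : ℝ) * (3 * δ / (4 * k)) = 3 / 4 * δ by field_simp]
    linarith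
  have hr : μ.real Aᶜ ≤ δ := ENNReal.toReal_le_of_le_ofReal hδ0.le hμ
  have hsum := probReal_compl_eq_one_sub₀ hAm
  linarith
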